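/- **Setting.** Let $\widehat W:\mathbb Z\to\mathbb C$ with $|\widehat W(k)|=|k|^{-2}$ for $k\ne0$, let $0<\delta<0.1$ and let $\psi\in\mathcal S(\mathbb R)$ have Fourier transform $\hat\psi(\xi)=\int e^{-i\xi v}\psi(v)\,dv$ supported in $(-\delta,\delta)$. For $\varepsilon\in\mathbb R$ consider on $\mathbb T\times\mathbb R$ the Vlasov–Poisson equation linearized around $\varepsilon\cos(x-tv)\psi(v)$, in coordinates moving with free transport, $$\partial_t h+F[h](t,x+tv)\,(\partial_v-t\partial_x)\big(\varepsilon\cos(x)\psi(v)\big)=0,\qquad \widehat{F[h]}(t,k)=ik\,\widehat W(k)\,\tilde h(t,k,kt),$$ where $\tilde h(t,k,\eta)$, $k\in\mathbb Z$, $\eta\in\mathbb R$, is the Fourier transform in $(x,v)$. A solution on $[T_0,\infty)$ with datum $h_{T_0}$ is a function with $\int_{T_0}^T\sum_k|\widehat{F[h]}(t,k)|^2dt<\infty$ for all $T$ such that, for all $t\ge T_0$, $k$, $\eta$, $$\tilde h(t,k,\eta)=\tilde h_{T_0}(k,\eta)-\sum_{l=k\pm1}\int_{T_0}^t\widehat{F[h]}(s,l)\;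 i(\eta-ks)\,\tfrac{\varepsilon}{2}\,\hat\psi(\eta-ls)\,ds .$$ Write $E_c(g)=\sum_k\int|\tilde g(k,\eta)|^2e^{c|\eta|^{1/3}}d\eta$ and $\|F(t)\|^2=\sum_k|\widehat F(t,k)|^2$. For data $h_{T_0}$ and solutions on $[T_0,\infty)$, call the problem *$c$-stable from time $T_0$* if there is a constant $C$, independent of the datum, such that whenever $E_c(h_{T_0})<\infty$ the solution satisfies * $E_1(h(t))\le C\,E_c(h_{T_0})$ for all $t\ge T_0$; * there is $h_\infty$ with $E_1(h_\infty)\le C\,E_c(h_{T_0})$ and $E_1(h(t)-h_\infty)\to0$ as $t\to\infty$; * (linear Landau damping) $\int_{T_0}^\infty\|F[h](t)\|^2dt\le C\,E_c(h_{T_0})$ and $\|F[h](t)-F[h_{T_0}](t)\|\to0$ as $t\to\infty$, where $F[h_{T_0}](t)$ is the force field of the free transport evolution of the datum, $\widehat{F[h_{T_0}]}(t,k)=ik\widehat W(k)\tilde h_{T_0}(k,kt)$; in particular $\|F[h](t)\|\to0$ whenever $\|F[h_{T_0}](t)\|\to0$. **Theorem.** 1. (Well-posedness) For all $\varepsilon\in\mathbb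 R$, $T_0\ge0$ and every datum with $E_0(h_{T_0})<\infty$ there is exactly one solution on $[T_0,\infty)$. 2. (Times in $[0,100]$) For all $\varepsilon\in\mathbb R$ and $c>0$ (in particular $c=2$) there is $C$ such that for every datum at time $0$ with $E_c(h_0)<\infty$ the solution satisfies $E_c(h(t))\le C\,E_c(h_0)$ for all $t\in[0,100]$. 3. (Gevrey 3 stability with a large constant) For every $\varepsilon\in\mathbb R$ there is $c_0>0$ such that for every $c\ge c_0$ the problem is $c$-stable from time $100$ and from time $0$. 4. (Constant $2$) There is $\varepsilon_0>0$ such that for all $|\varepsilon|\le\varepsilon_0$ the problem is $2$-stable from time $100$ and from time $0$: in particular, if $\sum_k\int|\tilde h_{100}|^2e^{2|\eta|^{1/3}}d\eta=C_{100}<\infty$, then $\sum_k\int|\tilde h(t)|^2e^{|\eta|^{1/3}}d\eta\le C\,C_{100}$ for all $t>100$. -/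

import Mathlib

open Filter Topology MeasureTheory Set
open scoped ENNReal NNReal FourierTransform SchwartzMap

noncomputable section

/-- The Fourier transform `ψ̂(ξ) = ∫ e^{-i ξ v} ψ(v) dv` with angular frequency `ξ`, in terms of
Mathlib's transform `𝓕 ψ (y) = ∫ e^{-2π i y v} ψ(v) dv`. -/
def psiHat (ψ : 𝓢(ℝ, ℂ)) (ξ : ℝ) : ℂ :=
  𝓕 (ψ : ℝ → ℂ) (ξ / (2 * Real.pi))

/-- The `k`-th Fourier coefficient `i k Ŵ(k) ρ̂(t,k)` of the force field `F = ∂ₓ W * ρ`. In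
coordinates `(x + t v, v)` moving with free transport the density is
`ρ(t,x) = ∫ h(t, x - t w, w) dw`, hence `ρ̂(t,k) = h̃(t,k,k t)`. Here `h t k η` stands for the
Fourier transform `h̃(t,k,η)`, `k ∈ ℤ`, `η ∈ ℝ`, of a function on `𝕋 × ℝ`. -/
def force (W : ℤ → ℂ) (h : ℝ → ℤ → ℝ → ℂ) (t : ℝ) (k : ℤ) : ℂ :=
  Complex.I * (k : ℂ) * W k * h t k ((k : ℝ) * t)

/-- The squared norm `∑_k |F̂(k)|²`, that is the `L²` norm of a field on `𝕋` up to normalization. -/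
def fieldSq (F : ℤ → ℂ) : ℝ≥0∞ :=
  ∑' k : ℤ, ‖F k‖ₑ ^ 2

/-- The Gevrey 3 energy `∑_k ∫ |g(k,η)|² exp (c |η|^{1/3}) dη`; for `c = 0` it is the square of
the `L²` norm. -/
def gevreyEnergy (c : ℝ) (g : ℤ → ℝ → ℂ) : ℝ≥0∞ :=
  ∑' k : ℤ, ∫⁻ η : ℝ, ‖g k η‖ₑ ^ 2 * ENNReal.ofReal (Real.exp (c * |η| ^ (1 / 3 : ℝ)))

/-- `h` is, on the Fourier side, a solution on `[T₀, ∞)` with datum `h₀` at time `T₀` of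
`∂ₜ h + F(t, x + t v) (∂ᵥ - t ∂ₓ) (ε cos(x) ψ(v)) = 0`.
In `(∂ᵥ - t ∂ₓ) (ε cos(x) ψ(v))` only `e^{i m x}` with `m = ± 1` occur, and the Fourier transform
in `v` of their coefficients is `i (ξ - t m) (ε / 2) ψ̂(ξ)`; multiplication by `F(t, x + t v)` couples the mode `l` of `F` and
`(m, ξ) = (k - l, η - l t)` to `(k, η)`, and `ξ - t m = η - k t`. The equation is written in its
Duhamel form, and the force field is required to be locally square integrable in space-time, so
that all integrals exist. -/
structure IsLVPSolution (W : ℤ → ℂ) (ε : ℝ) (ψ : 𝓢(ℝ, ℂ)) (T₀ : ℝ) (h₀ : ℤ → ℝ → ℂ)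
    (h : ℝ → ℤ → ℝ → ℂ) : Prop where
  force_measurable : ∀ l : ℤ,
    AEStronglyMeasurable (fun t : ℝ => force W h t l) (volume.restrict (Ici T₀))
  force_sq_integrable : ∀ T : ℝ, (∫⁻ t in Icc T₀ T, fieldSq (force W h t)) < ∞
  duhamel : ∀ t : ℝ, T₀ ≤ t → ∀ (k : ℤ) (η : ℝ),
    h t k η = h₀ k η - ∑ l ∈ ({k - 1, k + 1} : Finset ℤ),
      ∫ s in T₀..t, force W h s l *
        (Complex.I * ((η - k * s : ℝ) : ℂ) * ((ε / 2 : ℝ) : ℂ) * psiHat ψ (η - l * s))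

/-- Gevrey 3 stability, with constants `c` for the data and `1` for the solution, and linear Landau
damping for the problem started at time `T₀`. -/
def GevreyStable (W : ℤ → ℂ) (ε : ℝ) (ψ : 𝓢(ℝ, ℂ)) (T₀ c : ℝ) : Prop :=
  ∃ C : ℝ≥0, ∀ (h₀ : ℤ → ℝ → ℂ) (h : ℝ → ℤ → ℝ → ℂ),
    (∀ k, AEStronglyMeasurable (h₀ k) volume) → gevreyEnergy c h₀ < ∞ →
    IsLVPSolution W ε ψ T₀ h₀ h →
      -- uniform bound
      (∀ t, T₀ ≤ t → gevreyEnergy 1 (h t) ≤ C * gevreyEnergy c h₀) ∧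
      -- convergence to a free transport solution (stationary in the moving coordinates)
      (∃ hInf : ℤ → ℝ → ℂ, (∀ k, AEStronglyMeasurable (hInf k) volume) ∧
        gevreyEnergy 1 hInf ≤ C * gevreyEnergy c h₀ ∧
        Tendsto (fun t => gevreyEnergy 1 (h t - hInf)) atTop (𝓝 0)) ∧
      -- decay of the force field, in `L²` in time
      (∫⁻ t in Ici T₀, fieldSq (force W h t)) ≤ C * gevreyEnergy c h₀ ∧
      -- the force field approaches that of the free transport evolution of the datum
      Tendsto (fun t => fieldSq (force W h t - force W (fun _ => h₀) t)) atTop (𝓝 0) ∧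
      -- decay of the force field, pointwise in time, if free transport of the datum has it
      (Tendsto (fun t => fieldSq (force W (fun _ => h₀) t)) atTop (𝓝 0) →
        Tendsto (fun t => fieldSq (force W h t)) atTop (𝓝 0))

end

/-!
Write `f t k` for the force coefficient and `f₀ t k` for that of free transport of the datum. On
the line `η = k t` the Duhamel formula is a Volterra equation for `f`, in which mode `k` at time
`t` is driven by the modes `l = k ± 1` at earlier times `s`. Since `|k Ŵ(k)| |k| = 1`, its kernel
is bounded by `A (t - s)` with `A = |ε| sup |ψ̂| / 2`, and it is supported in the resonance band
`|k t - l s| < δ`. The solution is an explicit integral of `f`, so that everything reduces to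
weighted `L²` bounds of `f`, which come from Schur's test.

*Bounded times.* In the band the Gevrey weights of `k t` and `l s` are comparable, and the weight
`e^{-r t}` with large `r` makes the Volterra operator a contraction. This yields existence
(`exists_isLVPSolution`, by the Banach fixed point theorem), uniqueness (`IsLVPSolution.unique`),
and the bound without loss in the exponent (`exists_gevreyEnergy_Icc_le`).

*Times after `100`.* There, mode `k` resonates only with the neighbour farther away from zero
(`natAbs_eq_of_resonance`), so that echoes travel along chains `… → n + 1 → n → …` with `n = |k|`
and `n t ≈ (n + 1) s`. At frequency `η = n t` one step has amplitude about `A η / n ^ 2` and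
duration about `δ / n`, so it amplifies by a multiple of `A η / n ^ 3`, and a chain by at most
`exp (C (A η)^{1/3})`. The weight `chainWeight` is built to decrease along chains: its factor
`(∑_{j < n} x ^ j / j!) ^ 3`, `x = b ζ^{1/3}`, `b ^ 3 ≥ 2 A`, is at least `(x / n) ^ 3` times
larger for `n + 1` than for `n` (`div_mul_expPartial_le`) and never exceeds `e^{3 x}`; the
variable `ζ = n (t + δ)`, in place of the frequency `n t`, is monotone along chains in spite of
the width of the band. In `weightedSq_chainWeight_le` the equation is truncated to the regions
`n (t - δ) ≤ N`, which the driving modes do not leave; there all norms are finite and the integral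
term can be absorbed.

The weight lies between `e^{0.6 |η|^{1/3}}` and `e^{(c/2) |η|^{1/3}}` if `1.32 + 6.6 b ≤ c`: a
large `c` always suffices, and `c = 2` does for small `ε`. The surplus of `0.6` over `1/2` absorbs
the factor `η - k s` of the Duhamel formula, and stability follows (`gevreyStable_hundred`). A
problem started at time `0` is restarted at time `100` (`gevreyStable_zero`).
-/

noncomputable section

/-! ### Schur's test and sums over neighbouring modes -/

theorem ENNReal.add_sq_le_two_mul (x y : ℝ≥0∞) : (x + y) ^ 2 ≤ 2 * x ^ 2 + 2 * y ^ 2 := by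
  have h := ENNReal.rpow_add_le_mul_rpow_add_rpow x y (p := 2) (by norm_num)
  norm_num at h
  rw [mul_add] at h
  exact_mod_cast h

/-- Cauchy–Schwarz with respect to the weight `a`. -/
theorem lintegral_mul_sq_le {μ : Measure ℝ} {a u : ℝ → ℝ≥0∞} (ha : AEMeasurable a μ)
    (hu : AEMeasurable u μ) :
    (∫⁻ s, a s * u s ∂μ) ^ 2 ≤ (∫⁻ s, a s ∂μ) * ∫⁻ s, a s * u s ^ 2 ∂μ := by
  have h := ENNReal.lintegral_mul_norm_pow_le (p := 1 / 2) (q := 1 / 2) ha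
    (ha.mul (hu.pow_const 2)) (by norm_num) (by norm_num) (by norm_num)
  have hpt : ∀ s, a s ^ (1 / 2 : ℝ) * (a s * u s ^ 2) ^ (1 / 2 : ℝ) = a s * u s := by
    intro s
    rw [ENNReal.mul_rpow_of_nonneg _ _ (by norm_num), ← mul_assoc,
      ← ENNReal.rpow_add_of_nonneg _ _ (by norm_num) (by norm_num), ← ENNReal.rpow_natCast,
      ← ENNReal.rpow_mul]
    norm_num
  simp only [Pi.mul_apply, hpt] at h
  calc (∫⁻ s, a s * u s ∂μ) ^ 2
      ≤ ((∫⁻ s, a s ∂μ) ^ (1 / 2 : ℝ) * (∫⁻ s, a s * u s ^ 2 ∂μ) ^ (1 / 2 : ℝ)) ^ 2 := by gcongr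
    _ = _ := by
      rw [mul_pow, ← ENNReal.rpow_natCast, ← ENNReal.rpow_natCast, ← ENNReal.rpow_mul,
        ← ENNReal.rpow_mul]
      norm_num

theorem aemeasurable_lintegral_kernel {μ ν : Measure ℝ} [SFinite μ]
    {a : ℝ → ℝ → ℝ≥0∞} (ha : Measurable (Function.uncurry a)) {u : ℝ → ℝ≥0∞}
    (hu : AEMeasurable u μ) : AEMeasurable (fun t => ∫⁻ s, a t s * u s ∂μ) ν := by
  have : (fun t => ∫⁻ s, a t s * u s ∂μ) = fun t => ∫⁻ s, a t s * hu.mk u s ∂μ := by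
    funext t
    refine lintegral_congr_ae ?_
    filter_upwards [hu.ae_eq_mk] with s hs
    rw [hs]
  rw [this]
  have hm : Measurable fun x : ℝ × ℝ => a x.1 x.2 * hu.mk u x.2 :=
    Measurable.mul ha (hu.measurable_mk.comp measurable_snd)
  exact hm.lintegral_prod_right'.aemeasurable

/-- Schur's test for the `L²` norm of an integral operator with a nonnegative kernel. -/
theorem lintegral_sq_kernel_le {μ ν : Measure ℝ} [SFinite μ] [SFinite ν]
    {a : ℝ → ℝ → ℝ≥0∞} (ha : Measurable (Function.uncurry a)) {p q : ℝ≥0∞}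
    (hp : ∀ t, ∫⁻ s, a t s ∂μ ≤ p) (hq : ∀ s, ∫⁻ t, a t s ∂ν ≤ q) {u : ℝ → ℝ≥0∞}
    (hu : AEMeasurable u μ) :
    ∫⁻ t, (∫⁻ s, a t s * u s ∂μ) ^ 2 ∂ν ≤ p * q * ∫⁻ s, u s ^ 2 ∂μ := by
  have hae : ∀ {g : ℝ → ℝ≥0∞}, AEMeasurable g μ →
      AEMeasurable (fun x : ℝ × ℝ => a x.1 x.2 * g x.2) (ν.prod μ) := fun hg =>
    AEMeasurable.mul ha.aemeasurable hg.comp_snd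
  calc ∫⁻ t, (∫⁻ s, a t s * u s ∂μ) ^ 2 ∂ν
      ≤ ∫⁻ t, p * ∫⁻ s, a t s * u s ^ 2 ∂μ ∂ν := by
        refine lintegral_mono fun t => ?_
        refine (lintegral_mul_sq_le (ha.comp measurable_prodMk_left).aemeasurable hu).trans ?_
        exact mul_le_mul_left (hp t) _
    _ = p * ∫⁻ t, ∫⁻ s, a t s * u s ^ 2 ∂μ ∂ν :=
        lintegral_const_mul'' _ (aemeasurable_lintegral_kernel ha (hu.pow_const 2))
    _ = p * ∫⁻ s, (∫⁻ t, a t s ∂ν) * u s ^ 2 ∂μ := by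
        rw [lintegral_lintegral_swap (hae (hu.pow_const 2))]
        congr 1
        refine lintegral_congr fun s => ?_
        exact lintegral_mul_const _ (ha.comp measurable_prodMk_right)
    _ ≤ p * ∫⁻ s, q * u s ^ 2 ∂μ := by
        gcongr with s
        exact hq s
    _ = _ := by rw [lintegral_const_mul'' _ (hu.pow_const 2), mul_assoc]

theorem sum_neighbors {M : Type*} [AddCommMonoid M] (k : ℤ) (f : ℤ → M) :
    ∑ l ∈ ({k - 1, k + 1} : Finset ℤ), f l = f (k - 1) + f (k + 1) :=
  Finset.sum_pair (by omega)

theorem mem_neighbors {k l : ℤ} : l ∈ ({k - 1, k + 1} : Finset ℤ) ↔ l = k - 1 ∨ l = k + 1 := by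
  simp

/-- Summation over all modes of a bound between neighbouring modes: every mode has two
neighbours. -/
theorem tsum_lintegral_neighbors_sq_le {ν : ℤ → Measure ℝ} {S : ℤ → ℤ → ℝ → ℝ≥0∞}
    {U : ℤ → ℝ≥0∞} {C : ℝ≥0∞} (hS : ∀ k l, AEMeasurable (S k l) (ν k))
    (h : ∀ k, ∀ l ∈ ({k - 1, k + 1} : Finset ℤ), ∫⁻ t, S k l t ^ 2 ∂(ν k) ≤ C * U l) :
    ∑' k, ∫⁻ t, (∑ l ∈ ({k - 1, k + 1} : Finset ℤ), S k l t) ^ 2 ∂(ν k)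
      ≤ 4 * C * ∑' l, U l := by
  have h1 : ∀ k, ∫⁻ t, (∑ l ∈ ({k - 1, k + 1} : Finset ℤ), S k l t) ^ 2 ∂(ν k)
      ≤ 2 * C * U (k - 1) + 2 * C * U (k + 1) := by
    intro k
    calc ∫⁻ t, (∑ l ∈ ({k - 1, k + 1} : Finset ℤ), S k l t) ^ 2 ∂(ν k)
        ≤ ∫⁻ t, (2 * S k (k - 1) t ^ 2 + 2 * S k (k + 1) t ^ 2) ∂(ν k) := by
          refine lintegral_mono fun t => ?_
          rw [sum_neighbors]
          exact ENNReal.add_sq_le_two_mul _ _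
      _ = 2 * ∫⁻ t, S k (k - 1) t ^ 2 ∂(ν k) + 2 * ∫⁻ t, S k (k + 1) t ^ 2 ∂(ν k) := by
          rw [lintegral_add_left' (((hS _ _).pow_const 2).const_mul _),
            lintegral_const_mul'' _ ((hS _ _).pow_const 2),
            lintegral_const_mul'' _ ((hS _ _).pow_const 2)]
      _ ≤ 2 * (C * U (k - 1)) + 2 * (C * U (k + 1)) := by
          gcongr
          · exact h k _ (by simp)
          · exact h k _ (by simp)
      _ = _ := by ring
  calc _ ≤ ∑' k : ℤ, (2 * C * U (k - 1) + 2 * C * U (k + 1)) := ENNReal.tsum_le_tsum h1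
    _ = _ := by
      have e1 : ∑' k : ℤ, U (k - 1) = ∑' k, U k := (Equiv.subRight (1 : ℤ)).tsum_eq U
      have e2 : ∑' k : ℤ, U (k + 1) = ∑' k, U k := (Equiv.addRight (1 : ℤ)).tsum_eq U
      rw [ENNReal.tsum_add, ENNReal.tsum_mul_left, ENNReal.tsum_mul_left, e1, e2]
      ring

/-! ### The resonance band -/

/-- The indicator function of `|x| < δ`. -/
def band (δ x : ℝ) : ℝ≥0∞ := if |x| < δ then 1 else 0

@[fun_prop]
theorem measurable_band (δ : ℝ) : Measurable (band δ) :=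
  Measurable.ite (measurableSet_lt measurable_norm measurable_const) measurable_const
    measurable_const

theorem band_le_one (δ x : ℝ) : band δ x ≤ 1 := by
  unfold band; split_ifs <;> simp

theorem lintegral_band_mul_sub_le {δ : ℝ} {l : ℝ} (hl : l ≠ 0) (x : ℝ) :
    ∫⁻ s, band δ (l * s - x) ≤ ENNReal.ofReal (2 * (δ / |l|)) := by
  have h : ∀ s, band δ (l * s - x) = (Metric.ball (x / l) (δ / |l|)).indicator 1 s := by
    intro s
    have : |l * s - x| < δ ↔ s ∈ Metric.ball (x / l) (δ / |l|) := by
      rw [Metric.mem_ball, Real.dist_eq, lt_div_iff₀ (abs_pos.2 hl), ← abs_mul]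
      have : (s - x / l) * l = l * s - x := by field_simp
      rw [this]
    by_cases hs : |l * s - x| < δ
    · simp [band, hs, this.1 hs]
    · simp [band, hs, mt this.2 hs]
  simp_rw [h]
  rw [lintegral_indicator_one measurableSet_ball, Real.volume_ball]

theorem lintegral_band_sub_mul_le {δ : ℝ} {l : ℝ} (hl : l ≠ 0) (x : ℝ) :
    ∫⁻ s, band δ (x - l * s) ≤ ENNReal.ofReal (2 * (δ / |l|)) := by
  have h : ∀ s, band δ (x - l * s) = band δ (l * s - x) := fun s => by
    unfold band; rw [abs_sub_comm]
  simp_rw [h]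
  exact lintegral_band_mul_sub_le hl x

/-! ### The cube root and the partial sums of the exponential series -/

theorem cbrt_le_add_of_abs_sub_le {x y d : ℝ} (h : |x - y| ≤ d) :
    |x| ^ (1 / 3 : ℝ) ≤ |y| ^ (1 / 3 : ℝ) + d ^ (1 / 3 : ℝ) := by
  have hd : 0 ≤ d := (abs_nonneg _).trans h
  have h1 : |x| ≤ |y| + d := by
    have := abs_add_le (x - y) y
    rw [sub_add_cancel] at this
    linarith
  exact (Real.rpow_le_rpow (abs_nonneg _) h1 (by norm_num)).trans
    (Real.rpow_add_le_add_rpow (abs_nonneg _) hd (by norm_num) (by norm_num))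

theorem cbrt_pow_three {x : ℝ} (hx : 0 ≤ x) : (x ^ (1 / 3 : ℝ)) ^ 3 = x := by
  rw [← Real.rpow_natCast, ← Real.rpow_mul hx]; norm_num

/-- The partial sum `∑_{j < n} x ^ j / j!` of the exponential series. -/
def expPartial (n : ℕ) (x : ℝ) : ℝ := ∑ j ∈ Finset.range n, x ^ j / j.factorial

theorem expPartial_nonneg {x : ℝ} (hx : 0 ≤ x) (n : ℕ) : 0 ≤ expPartial n x :=
  Finset.sum_nonneg fun _ _ => by positivity

theorem expPartial_le_exp {x : ℝ} (hx : 0 ≤ x) (n : ℕ) : expPartial n x ≤ Real.exp x :=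
  Real.sum_le_exp_of_nonneg hx n

theorem one_le_expPartial {x : ℝ} (hx : 0 ≤ x) {n : ℕ} (hn : n ≠ 0) : 1 ≤ expPartial n x := by
  obtain ⟨m, rfl⟩ := Nat.exists_eq_succ_of_ne_zero hn
  unfold expPartial
  rw [Finset.sum_range_succ']
  simp only [pow_zero, Nat.factorial_zero, Nat.cast_one, div_one, le_add_iff_nonneg_left]
  exact Finset.sum_nonneg fun _ _ => by positivity

theorem expPartial_mono {x y : ℝ} (hx : 0 ≤ x) (hxy : x ≤ y) (n : ℕ) :
    expPartial n x ≤ expPartial n y := by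
  unfold expPartial
  gcongr

/-- An echo from mode `n + 1` to mode `n` amplifies by the factor `(x / n) ^ 3`; the partial sums
grow fast enough in `n` to absorb the cube root of it. -/
theorem div_mul_expPartial_le {x : ℝ} (hx : 0 ≤ x) {n : ℕ} (hn : n ≠ 0) :
    x / n * expPartial n x ≤ expPartial (n + 1) x := by
  unfold expPartial
  rw [Finset.mul_sum, Finset.sum_range_succ']
  have hn' : (0 : ℝ) < n := by positivity
  have : ∑ j ∈ Finset.range n, x / n * (x ^ j / j.factorial)
      ≤ ∑ j ∈ Finset.range n, x ^ (j + 1) / (j + 1).factorial := by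
    refine Finset.sum_le_sum fun j hj => ?_
    have hj' : (j : ℝ) + 1 ≤ n := by exact_mod_cast Finset.mem_range.1 hj
    rw [Nat.factorial_succ, div_mul_div_comm, pow_succ']
    push_cast
    gcongr
  refine this.trans ?_
  simp

theorem measurable_expPartial (n : ℕ) : Measurable (expPartial n) := by
  unfold expPartial
  fun_prop

/-! ### Weighted estimates for operators coupling neighbouring modes -/

/-- The weighted space-time norm `∑_k ∫_S (w k t) ^ 2 |f t k| ^ 2 dt`. -/
def weightedSq (S : Set ℝ) (w : ℤ → ℝ → ℝ≥0∞) (f : ℝ → ℤ → ℂ) : ℝ≥0∞ :=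
  ∑' k : ℤ, ∫⁻ t in S, (w k t * ‖f t k‖ₑ) ^ 2

theorem weightedSq_mono_set {S S' : Set ℝ} (h : S ⊆ S') (w : ℤ → ℝ → ℝ≥0∞) (f : ℝ → ℤ → ℂ) :
    weightedSq S w f ≤ weightedSq S' w f :=
  ENNReal.tsum_le_tsum fun _ => lintegral_mono_set h

theorem weightedSq_mono_weight {S : Set ℝ} (hS : MeasurableSet S) {w w' : ℤ → ℝ → ℝ≥0∞}
    {f : ℝ → ℤ → ℂ} (hf0 : ∀ t, f t 0 = 0) (h : ∀ k, k ≠ 0 → ∀ t ∈ S, w k t ≤ w' k t) :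
    weightedSq S w f ≤ weightedSq S w' f := by
  refine ENNReal.tsum_le_tsum fun k => setLIntegral_mono_ae' hS (Eventually.of_forall ?_)
  intro t ht
  by_cases hk : k = 0
  · simp [hk, hf0]
  · gcongr
    exact h k hk t ht

/-- An `L²` bound for kernels that couple each mode to its neighbours: if, up to weights, the
kernel `κ k l` is dominated by a kernel satisfying Schur's condition, the operator is bounded. The
modes without the property `P` are absent from `f`. -/
theorem tsum_lintegral_kernel_sq_le {ν : ℤ → Measure ℝ} [∀ k, SFinite (ν k)] {S : Set ℝ}
    (hS : MeasurableSet S) {f : ℝ → ℤ → ℂ}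
    (hf : ∀ l, AEStronglyMeasurable (fun t => f t l) (volume.restrict S))
    {P : ℤ → Prop} (hf0 : ∀ t l, ¬P l → f t l = 0) {w : ℤ → ℝ → ℝ≥0∞} (hw : ∀ l, Measurable (w l))
    {κ a : ℤ → ℤ → ℝ → ℝ → ℝ≥0∞} (ha : ∀ k l, Measurable (Function.uncurry (a k l)))
    (hκ : ∀ k, ∀ l ∈ ({k - 1, k + 1} : Finset ℤ), P l →
      ∀ᵐ t ∂(ν k), ∀ s ∈ S, κ k l t s ≤ a k l t s * w l s)
    {p q : ℤ → ℤ → ℝ≥0∞} {D : ℝ≥0∞}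
    (hp : ∀ k, ∀ l ∈ ({k - 1, k + 1} : Finset ℤ), P l → ∀ t, ∫⁻ s in S, a k l t s ≤ p k l)
    (hq : ∀ k, ∀ l ∈ ({k - 1, k + 1} : Finset ℤ), P l → ∀ s, ∫⁻ t, a k l t s ∂(ν k) ≤ q k l)
    (hpq : ∀ k, ∀ l ∈ ({k - 1, k + 1} : Finset ℤ), P l → p k l * q k l ≤ D) :
    ∑' k, ∫⁻ t, (∑ l ∈ ({k - 1, k + 1} : Finset ℤ), ∫⁻ s in S, κ k l t s * ‖f s l‖ₑ) ^ 2 ∂(ν k)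
      ≤ 4 * D * weightedSq S w f := by
  have hu : ∀ l, AEMeasurable (fun s => w l s * ‖f s l‖ₑ) (volume.restrict S) := fun l =>
    (hw l).aemeasurable.mul (hf l).enorm
  refine le_trans (ENNReal.tsum_le_tsum fun k => lintegral_mono_ae ?_)
    (tsum_lintegral_neighbors_sq_le (ν := ν)
      (S := fun k l t => ∫⁻ s in S, a k l t s * (w l s * ‖f s l‖ₑ)) (C := D)
      (fun k l => aemeasurable_lintegral_kernel (ha k l) (hu l)) ?_)
  · have : ∀ᵐ t ∂(ν k), ∀ l ∈ ({k - 1, k + 1} : Finset ℤ), P l →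
        ∀ s ∈ S, κ k l t s ≤ a k l t s * w l s := by
      rw [ae_all_iff]
      intro l
      by_cases hl : l ∈ ({k - 1, k + 1} : Finset ℤ)
      · by_cases hl0 : P l
        · filter_upwards [hκ k l hl hl0] with t ht _ _
          exact ht
        · exact Eventually.of_forall fun t _ h => absurd h hl0
      · exact Eventually.of_forall fun t h => absurd h hl
    filter_upwards [this] with t ht
    refine pow_le_pow_left' (Finset.sum_le_sum fun l hl => ?_) 2
    refine setLIntegral_mono_ae' hS (Eventually.of_forall fun s hs => ?_)
    by_cases hl0 : P l
    · rw [← mul_assoc]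
      exact mul_le_mul_left (ht l hl hl0 s hs) _
    · simp [hf0 _ l hl0]
  · intro k l hl
    by_cases hl0 : P l
    swap
    · simp [hf0 _ l hl0]
    · refine (lintegral_sq_kernel_le (ha k l) (hp k l hl hl0) (hq k l hl hl0) (hu l)).trans ?_
      exact mul_le_mul_left (hpq k l hl hl0) _

/-- A contraction estimate for a Volterra inequality between neighbouring modes. The finiteness
of the left hand side allows absorbing the integral term. -/
theorem weightedSq_le_of_volterra {T₀ : ℝ} {f f₀ : ℝ → ℤ → ℂ}
    (hf : ∀ l, AEStronglyMeasurable (fun t => f t l) (volume.restrict (Ici T₀)))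
    (hf0 : ∀ t, f t 0 = 0) {κ : ℤ → ℤ → ℝ → ℝ → ℝ≥0∞}
    (hle : ∀ t, T₀ ≤ t → ∀ k, ‖f t k‖ₑ ≤ ‖f₀ t k‖ₑ
      + ∑ l ∈ ({k - 1, k + 1} : Finset ℤ), ∫⁻ s in Ici T₀, κ k l t s * ‖f s l‖ₑ)
    {w : ℤ → ℝ → ℝ≥0∞} (hw : ∀ l, Measurable (w l)) {a : ℤ → ℤ → ℝ → ℝ → ℝ≥0∞}
    (ha : ∀ k l, Measurable (Function.uncurry (a k l)))
    (hκ : ∀ k, ∀ l ∈ ({k - 1, k + 1} : Finset ℤ), l ≠ 0 →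
      ∀ t, T₀ ≤ t → ∀ s, T₀ ≤ s → w k t * κ k l t s ≤ a k l t s * w l s)
    {p q : ℤ → ℤ → ℝ≥0∞}
    (hp : ∀ k, ∀ l ∈ ({k - 1, k + 1} : Finset ℤ), l ≠ 0 → ∀ t, ∫⁻ s, a k l t s ≤ p k l)
    (hq : ∀ k, ∀ l ∈ ({k - 1, k + 1} : Finset ℤ), l ≠ 0 → ∀ s, ∫⁻ t, a k l t s ≤ q k l)
    (hpq : ∀ k, ∀ l ∈ ({k - 1, k + 1} : Finset ℤ), l ≠ 0 → p k l * q k l ≤ 16⁻¹)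
    (hfin : weightedSq (Ici T₀) w f < ∞) :
    weightedSq (Ici T₀) w f ≤ 4 * weightedSq (Ici T₀) w f₀ := by
  set X := weightedSq (Ici T₀) w f with hX
  have hu : ∀ l, AEMeasurable (fun s => w l s * ‖f s l‖ₑ) (volume.restrict (Ici T₀)) := fun l =>
    (hw l).aemeasurable.mul (hf l).enorm
  let R : ℤ → ℝ → ℝ≥0∞ := fun k t =>
    ∑ l ∈ ({k - 1, k + 1} : Finset ℤ), ∫⁻ s in Ici T₀, a k l t s * (w l s * ‖f s l‖ₑ)
  have hR : ∀ k, AEMeasurable (R k) (volume.restrict (Ici T₀)) := fun k =>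
    Finset.aemeasurable_fun_sum _ fun l _ => aemeasurable_lintegral_kernel (ha k l) (hu l)
  have hRsum : ∑' k, ∫⁻ t in Ici T₀, R k t ^ 2 ≤ 4⁻¹ * X := by
    have h := tsum_lintegral_kernel_sq_le (ν := fun _ => volume.restrict (Ici T₀))
      measurableSet_Ici hf (P := (· ≠ 0)) (fun t l hl => by rw [not_not.1 hl, hf0]) hw
      (κ := fun k l t s => a k l t s * w l s) ha
      (fun k l _ _ => Eventually.of_forall fun t s _ => le_rfl)
      (fun k l hl hl0 t => (setLIntegral_le_lintegral _ _).trans (hp k l hl hl0 t))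
      (fun k l hl hl0 s => (setLIntegral_le_lintegral _ _).trans (hq k l hl hl0 s)) hpq
    have h4 : (4 : ℝ≥0∞) * 16⁻¹ = 4⁻¹ := by
      rw [show (16 : ℝ≥0∞) = 4 * 4 by norm_num,
        ENNReal.mul_inv (Or.inl (by norm_num)) (Or.inl (by norm_num)), ← mul_assoc,
        ENNReal.mul_inv_cancel (by norm_num) (by norm_num), one_mul]
    rw [h4] at h
    simpa only [mul_assoc, R] using h
  have hpt : ∀ k, ∀ t ∈ Ici T₀, w k t * ‖f t k‖ₑ ≤ w k t * ‖f₀ t k‖ₑ + R k t := by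
    intro k t ht
    calc w k t * ‖f t k‖ₑ ≤ w k t * (‖f₀ t k‖ₑ
        + ∑ l ∈ ({k - 1, k + 1} : Finset ℤ), ∫⁻ s in Ici T₀, κ k l t s * ‖f s l‖ₑ) := by
          gcongr
          exact hle t ht k
      _ ≤ _ := by
        rw [mul_add, Finset.mul_sum]
        refine add_le_add_right (Finset.sum_le_sum fun l hl => ?_) _
        refine (lintegral_const_mul_le _ _).trans ?_
        refine setLIntegral_mono_ae' measurableSet_Ici (Eventually.of_forall fun s hs => ?_)
        by_cases hl0 : l = 0
        · simp [hl0, hf0]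
        · rw [← mul_assoc, ← mul_assoc]
          exact mul_le_mul_left (hκ k l hl hl0 t ht s hs) _
  have hmain : X ≤ 2 * weightedSq (Ici T₀) w f₀ + 2⁻¹ * X := by
    calc X ≤ ∑' k, (2 * (∫⁻ t in Ici T₀, (w k t * ‖f₀ t k‖ₑ) ^ 2)
          + 2 * ∫⁻ t in Ici T₀, R k t ^ 2) := by
          refine ENNReal.tsum_le_tsum fun k => ?_
          calc ∫⁻ t in Ici T₀, (w k t * ‖f t k‖ₑ) ^ 2
              ≤ ∫⁻ t in Ici T₀, (2 * (w k t * ‖f₀ t k‖ₑ) ^ 2 + 2 * R k t ^ 2) := by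
                refine setLIntegral_mono_ae' measurableSet_Ici (Eventually.of_forall ?_)
                intro t ht
                refine le_trans ?_ (ENNReal.add_sq_le_two_mul _ _)
                gcongr
                exact hpt k t ht
            _ = _ := by
              rw [lintegral_add_right' _ (((hR k).pow_const 2).const_mul _),
                lintegral_const_mul' _ _ (by norm_num), lintegral_const_mul' _ _ (by norm_num)]
      _ = 2 * weightedSq (Ici T₀) w f₀ + 2 * ∑' k, ∫⁻ t in Ici T₀, R k t ^ 2 := by
        rw [ENNReal.tsum_add, ENNReal.tsum_mul_left, ENNReal.tsum_mul_left]
        rfl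
      _ ≤ 2 * weightedSq (Ici T₀) w f₀ + 2 * (4⁻¹ * X) := by gcongr
      _ = _ := by
        rw [show (4 : ℝ≥0∞) = 2 * 2 by norm_num,
          ENNReal.mul_inv (Or.inl (by norm_num)) (Or.inl (by norm_num)), ← mul_assoc, ← mul_assoc,
          ENNReal.mul_inv_cancel (by norm_num) (by norm_num), one_mul]
  by_cases hY : weightedSq (Ici T₀) w f₀ = ∞
  · rw [hY]; simp
  · lift X to ℝ≥0 using hfin.ne with x
    lift weightedSq (Ici T₀) w f₀ to ℝ≥0 using hY with y
    have h2 : (2⁻¹ : ℝ≥0∞) = ((2⁻¹ : ℝ≥0) : ℝ≥0∞) := by simp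
    rw [h2] at hmain
    norm_cast at hmain ⊢
    have : (x : ℝ) ≤ 2 * y + 2⁻¹ * x := by exact_mod_cast hmain
    have h' : (x : ℝ) ≤ 4 * y := by linarith
    exact_mod_cast h'

/-! ### The profile and the force field -/

theorem continuous_psiHat (ψ : 𝓢(ℝ, ℂ)) : Continuous (psiHat ψ) := by
  unfold psiHat
  rw [← SchwartzMap.fourier_coe]
  exact (SchwartzMap.continuous _).comp (by fun_prop)

theorem exists_norm_psiHat_le (ψ : 𝓢(ℝ, ℂ)) : ∃ M : ℝ, 0 ≤ M ∧ ∀ ξ, ‖psiHat ψ ξ‖ ≤ M :=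
  ⟨∫ v, ‖ψ v‖, integral_nonneg fun _ => norm_nonneg _, fun _ =>
    VectorFourier.norm_fourierIntegral_le_integral_norm _ _ _ _ _⟩

theorem enorm_psiHat_le {ψ : 𝓢(ℝ, ℂ)} {δ M : ℝ}
    (hψ : Function.support (psiHat ψ) ⊆ Ioo (-δ) δ) (hM : ∀ ξ, ‖psiHat ψ ξ‖ ≤ M) (ξ : ℝ) :
    ‖psiHat ψ ξ‖ₑ ≤ ENNReal.ofReal M * band δ ξ := by
  by_cases h : psiHat ψ ξ = 0
  · simp [h]
  · have h1 : |ξ| < δ := abs_lt.2 (hψ h)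
    rw [band, if_pos h1, mul_one, ← ofReal_norm]
    exact ENNReal.ofReal_le_ofReal (hM ξ)

/-- The multiplier of the Duhamel formula, by which the mode `l` of the force at time `s` acts on
the frequency `(k, η)`. -/
def duhamelKernel (ε : ℝ) (ψ : 𝓢(ℝ, ℂ)) (k l : ℤ) (η s : ℝ) : ℂ :=
  Complex.I * ((η - k * s : ℝ) : ℂ) * ((ε / 2 : ℝ) : ℂ) * psiHat ψ (η - l * s)

theorem continuous_uncurry_duhamelKernel (ε : ℝ) (ψ : 𝓢(ℝ, ℂ)) (k l : ℤ) :
    Continuous (Function.uncurry (duhamelKernel ε ψ k l)) := by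
  have := continuous_psiHat ψ
  unfold duhamelKernel Function.uncurry
  fun_prop

theorem continuous_duhamelKernel (ε : ℝ) (ψ : 𝓢(ℝ, ℂ)) (k l : ℤ) (η : ℝ) :
    Continuous (duhamelKernel ε ψ k l η) := by
  have := continuous_psiHat ψ
  unfold duhamelKernel
  fun_prop

theorem enorm_duhamelKernel_le {ψ : 𝓢(ℝ, ℂ)} {δ M : ℝ}
    (hψ : Function.support (psiHat ψ) ⊆ Ioo (-δ) δ) (hM : ∀ ξ, ‖psiHat ψ ξ‖ ≤ M) (ε : ℝ)
    (k l : ℤ) (η s : ℝ) :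
    ‖duhamelKernel ε ψ k l η s‖ₑ
      ≤ ENNReal.ofReal (|η - k * s| * (|ε| / 2 * M)) * band δ (η - l * s) := by
  unfold duhamelKernel
  rw [enorm_mul, enorm_mul, enorm_mul, ← mul_assoc |η - k * s|,
    ENNReal.ofReal_mul (by positivity), mul_assoc (ENNReal.ofReal _)]
  refine mul_le_mul' (le_of_eq ?_) (enorm_psiHat_le hψ hM _)
  rw [ENNReal.ofReal_mul (abs_nonneg _), ← ofReal_norm (_ : ℂ), ← ofReal_norm (_ : ℂ),
    ← ofReal_norm (_ : ℂ), Complex.norm_I, Complex.norm_real, Complex.norm_real]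
  simp

@[simp]
theorem force_zero_mode (W : ℤ → ℂ) (h : ℝ → ℤ → ℝ → ℂ) (t : ℝ) : force W h t 0 = 0 := by
  simp [force]

theorem norm_force_multiplier {W : ℤ → ℂ} (hW : ∀ k : ℤ, k ≠ 0 → ‖W k‖ = 1 / (k : ℝ) ^ 2)
    {k : ℤ} (hk : k ≠ 0) : ‖Complex.I * (k : ℂ) * W k‖ = 1 / |(k : ℝ)| := by
  have hk' : (k : ℝ) ≠ 0 := by exact_mod_cast hk
  rw [norm_mul, norm_mul, Complex.norm_I, hW k hk, Complex.norm_intCast, ← sq_abs]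
  have : |(k : ℝ)| ≠ 0 := abs_ne_zero.2 hk'
  field_simp

theorem one_le_abs_intCast {k : ℤ} (hk : k ≠ 0) : (1 : ℝ) ≤ |(k : ℝ)| := by
  exact_mod_cast Int.one_le_abs hk

theorem enorm_force_le {W : ℤ → ℂ} (hW : ∀ k : ℤ, k ≠ 0 → ‖W k‖ = 1 / (k : ℝ) ^ 2)
    (h : ℝ → ℤ → ℝ → ℂ) (t : ℝ) {k : ℤ} (hk : k ≠ 0) : ‖force W h t k‖ₑ ≤ ‖h t k (k * t)‖ₑ := by
  unfold force
  rw [enorm_mul, ← ofReal_norm (_ : ℂ), norm_force_multiplier hW hk]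
  refine mul_le_of_le_one_left' (ENNReal.ofReal_le_one.2 ?_)
  exact (div_le_one (by linarith [one_le_abs_intCast hk])).2 (one_le_abs_intCast hk)

theorem aestronglyMeasurable_comp_intCast_mul {g : ℝ → ℂ} (hg : AEStronglyMeasurable g volume)
    {k : ℤ} (hk : k ≠ 0) : AEStronglyMeasurable (fun t : ℝ => g (k * t)) volume :=
  hg.comp_quasiMeasurePreserving (f := fun t : ℝ => (k : ℝ) * t)
    (Measure.quasiMeasurePreserving_smul (μ := volume) (E := ℝ) (r := (k : ℝ))
      (by exact_mod_cast hk))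

theorem aestronglyMeasurable_force_freeTransport (W : ℤ → ℂ) {h₀ : ℤ → ℝ → ℂ}
    (hm : ∀ k, AEStronglyMeasurable (h₀ k) volume) (k : ℤ) :
    AEStronglyMeasurable (fun t => force W (fun _ => h₀) t k) volume := by
  by_cases hk : k = 0
  · subst hk
    simp [aestronglyMeasurable_const]
  · exact (aestronglyMeasurable_comp_intCast_mul (hm k) hk).const_mul _

theorem lintegral_comp_mul_left_le (g : ℝ → ℝ≥0∞) {a : ℝ} (ha : 1 ≤ |a|) :
    ∫⁻ t, g (a * t) ≤ ∫⁻ t, g t := by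
  have ha0 : a ≠ 0 := by rintro rfl; norm_num at ha
  have h := lintegral_map_equiv (μ := volume) g (MeasurableEquiv.mulLeft₀ a ha0)
  have h' : Measure.map (MeasurableEquiv.mulLeft₀ a ha0) volume = ENNReal.ofReal |a⁻¹| • volume :=
    Real.map_volume_mul_left ha0
  rw [h', lintegral_smul_measure] at h
  have h2 : ENNReal.ofReal |a⁻¹| ≤ 1 := by
    rw [ENNReal.ofReal_le_one, abs_inv]
    exact inv_le_one_of_one_le₀ ha
  calc ∫⁻ t, g (a * t) = ENNReal.ofReal |a⁻¹| • ∫⁻ t, g t := h.symm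
    _ ≤ _ := mul_le_of_le_one_left' h2

theorem ofReal_exp_half_sq (c x : ℝ) :
    ENNReal.ofReal (Real.exp (c / 2 * x)) ^ 2 = ENNReal.ofReal (Real.exp (c * x)) := by
  rw [← ENNReal.ofReal_pow (Real.exp_pos _).le, ← Real.exp_nat_mul]
  congr 2
  push_cast
  ring

/-- Space-time bound for the force field of free transport: along `η = k t` the integral over
time turns into the integral over the frequency. -/
theorem weightedSq_freeTransport_le {W : ℤ → ℂ} (hW : ∀ k : ℤ, k ≠ 0 → ‖W k‖ = 1 / (k : ℝ) ^ 2)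
    {S : Set ℝ} (hS : MeasurableSet S) {w : ℤ → ℝ → ℝ≥0∞} {c : ℝ}
    (hw : ∀ k, k ≠ 0 → ∀ t ∈ S,
      w k t ≤ ENNReal.ofReal (Real.exp (c / 2 * |(k : ℝ) * t| ^ (1 / 3 : ℝ))))
    (h₀ : ℤ → ℝ → ℂ) : weightedSq S w (force W fun _ => h₀) ≤ gevreyEnergy c h₀ := by
  refine ENNReal.tsum_le_tsum fun k => ?_
  by_cases hk : k = 0
  · simp [hk]
  · calc ∫⁻ t in S, (w k t * ‖force W (fun _ => h₀) t k‖ₑ) ^ 2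
        ≤ ∫⁻ t in S, ‖h₀ k (k * t)‖ₑ ^ 2
            * ENNReal.ofReal (Real.exp (c * |(k : ℝ) * t| ^ (1 / 3 : ℝ))) := by
          refine setLIntegral_mono_ae' hS (Eventually.of_forall fun t ht => ?_)
          rw [← ofReal_exp_half_sq, ← mul_pow, mul_comm ‖h₀ k (k * t)‖ₑ]
          gcongr
          · exact hw k hk t ht
          · exact enorm_force_le hW _ t hk
      _ ≤ ∫⁻ t, ‖h₀ k (k * t)‖ₑ ^ 2
            * ENNReal.ofReal (Real.exp (c * |(k : ℝ) * t| ^ (1 / 3 : ℝ))) :=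
          setLIntegral_le_lintegral _ _
      _ ≤ _ := lintegral_comp_mul_left_le
          (fun η => ‖h₀ k η‖ₑ ^ 2 * ENNReal.ofReal (Real.exp (c * |η| ^ (1 / 3 : ℝ))))
          (one_le_abs_intCast hk)

theorem lintegral_fieldSq {S : Set ℝ} {f : ℝ → ℤ → ℂ}
    (hf : ∀ l, AEStronglyMeasurable (fun t => f t l) (volume.restrict S)) :
    ∫⁻ t in S, fieldSq (f t) = weightedSq S (fun _ _ => 1) f := by
  unfold fieldSq weightedSq
  rw [lintegral_tsum fun k => (hf k).enorm.pow_const 2]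
  simp

/-- The kernel of the Volterra equation satisfied by the force field. -/
def forceKernel (δ A : ℝ) (k l : ℤ) (t s : ℝ) : ℝ≥0∞ :=
  if k ≠ 0 ∧ s ≤ t then ENNReal.ofReal ((t - s) * A) * band δ (k * t - l * s) else 0

theorem enorm_force_multiplier_mul_duhamelKernel_le {W : ℤ → ℂ}
    (hW : ∀ k : ℤ, k ≠ 0 → ‖W k‖ = 1 / (k : ℝ) ^ 2) {ψ : 𝓢(ℝ, ℂ)} {δ M : ℝ}
    (hψ : Function.support (psiHat ψ) ⊆ Ioo (-δ) δ) (hM : ∀ ξ, ‖psiHat ψ ξ‖ ≤ M)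
    (ε : ℝ) {k : ℤ} (hk : k ≠ 0) (l : ℤ) {t s : ℝ} (hst : s ≤ t) :
    ‖Complex.I * (k : ℂ) * W k‖ₑ * ‖duhamelKernel ε ψ k l (k * t) s‖ₑ
      ≤ forceKernel δ (|ε| / 2 * M) k l t s := by
  have hk' : |(k : ℝ)| ≠ 0 := abs_ne_zero.2 (by exact_mod_cast hk)
  rw [forceKernel, if_pos ⟨hk, hst⟩]
  calc _ ≤ ‖Complex.I * (k : ℂ) * W k‖ₑ *
        (ENNReal.ofReal (|k * t - k * s| * (|ε| / 2 * M)) * band δ (k * t - l * s)) := by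
        gcongr
        exact enorm_duhamelKernel_le hψ hM ε k l _ s
    _ = _ := by
      rw [← mul_assoc, ← ofReal_norm (_ : ℂ), norm_force_multiplier hW hk,
        ← ENNReal.ofReal_mul (by positivity), ← mul_sub, abs_mul, abs_of_nonneg (sub_nonneg.2 hst)]
      congr 2
      field_simp

/-! ### Consequences of the Duhamel formula -/

section Solution

variable {W : ℤ → ℂ} {ε : ℝ} {ψ : 𝓢(ℝ, ℂ)} {T₀ : ℝ} {h₀ : ℤ → ℝ → ℂ} {h : ℝ → ℤ → ℝ → ℂ}

theorem IsLVPSolution.aestronglyMeasurable (sol : IsLVPSolution W ε ψ T₀ h₀ h) {S : Set ℝ}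
    (hS : S ⊆ Ici T₀) (l : ℤ) :
    AEStronglyMeasurable (fun t => force W h t l) (volume.restrict S) :=
  (sol.force_measurable l).mono_measure (Measure.restrict_mono hS le_rfl)

theorem IsLVPSolution.weightedSq_one_lt_top (sol : IsLVPSolution W ε ψ T₀ h₀ h) (T : ℝ) :
    weightedSq (Icc T₀ T) (fun _ _ => 1) (force W h) < ∞ := by
  rw [← lintegral_fieldSq (sol.aestronglyMeasurable Icc_subset_Ici_self)]
  exact sol.force_sq_integrable T

theorem integrableOn_mul_duhamelKernel {f : ℝ → ℤ → ℂ}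
    (hf : ∀ l, AEStronglyMeasurable (fun t => f t l) (volume.restrict (Ici T₀))) {T : ℝ}
    (hfin : weightedSq (Icc T₀ T) (fun _ _ => 1) f < ∞) (ε : ℝ) (ψ : 𝓢(ℝ, ℂ)) (k l : ℤ) (η : ℝ) :
    IntegrableOn (fun s => f s l * duhamelKernel ε ψ k l η s) (Icc T₀ T) := by
  refine IntegrableOn.mul_continuousOn ?_ (continuous_duhamelKernel ε ψ k l η).continuousOn
    isCompact_Icc
  refine ⟨(hf l).mono_measure (Measure.restrict_mono Icc_subset_Ici_self le_rfl), ?_⟩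
  have hx : ∀ x : ℝ≥0∞, x ≤ 1 + x ^ 2 := fun x => by
    rcases le_total x 1 with hx | hx
    · exact hx.trans le_self_add
    · exact (le_self_pow hx two_ne_zero).trans le_add_self
  calc ∫⁻ s in Icc T₀ T, ‖f s l‖ₑ ≤ ∫⁻ s in Icc T₀ T, (1 + ‖f s l‖ₑ ^ 2) :=
        lintegral_mono fun s => hx _
    _ = volume (Icc T₀ T) + ∫⁻ s in Icc T₀ T, ‖f s l‖ₑ ^ 2 := by
        rw [lintegral_add_left measurable_const]
        simp
    _ < ∞ := by
        refine ENNReal.add_lt_top.2 ⟨measure_Icc_lt_top, lt_of_le_of_lt ?_ hfin⟩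
        have := ENNReal.le_tsum (f := fun l => ∫⁻ s in Icc T₀ T, (1 * ‖f s l‖ₑ) ^ 2) l
        simpa [weightedSq] using this

theorem IsLVPSolution.intervalIntegrable (sol : IsLVPSolution W ε ψ T₀ h₀ h) {a b : ℝ}
    (ha : T₀ ≤ a) (hb : T₀ ≤ b) (k l : ℤ) (η : ℝ) :
    IntervalIntegrable (fun s => force W h s l * duhamelKernel ε ψ k l η s) volume a b := by
  rw [intervalIntegrable_iff]
  refine (integrableOn_mul_duhamelKernel sol.force_measurable
    (sol.weightedSq_one_lt_top (max a b)) ε ψ k l η).mono_set ?_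
  exact Ioc_subset_Icc_self.trans (Icc_subset_Icc_left (le_min ha hb))

theorem IsLVPSolution.sub_eq (sol : IsLVPSolution W ε ψ T₀ h₀ h) {t : ℝ} (ht : T₀ ≤ t) (k : ℤ)
    (η : ℝ) : h t k η - h₀ k η = -∑ l ∈ ({k - 1, k + 1} : Finset ℤ),
      ∫ s in T₀..t, force W h s l * duhamelKernel ε ψ k l η s := by
  rw [sol.duhamel t ht k η]
  simp [duhamelKernel]

/-- Bound for the force field generated by the response to a force field `f`. The set `S` of times
has to contain all resonances. -/
theorem enorm_multiplier_mul_sum_integral_le (hW : ∀ k : ℤ, k ≠ 0 → ‖W k‖ = 1 / (k : ℝ) ^ 2)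
    {δ M : ℝ} (hψ : Function.support (psiHat ψ) ⊆ Ioo (-δ) δ) (hM : ∀ ξ, ‖psiHat ψ ξ‖ ≤ M)
    (ε T₀ : ℝ) (f : ℝ → ℤ → ℂ) (t : ℝ) (k : ℤ) {S : Set ℝ} (hS : MeasurableSet S)
    (hres : k ≠ 0 → ∀ l ∈ ({k - 1, k + 1} : Finset ℤ), ∀ s, T₀ ≤ s → s ≤ t →
      |k * t - l * s| < δ → s ∈ S) :
    ‖Complex.I * (k : ℂ) * W k * ∑ l ∈ ({k - 1, k + 1} : Finset ℤ),
        ∫ s in Ioc T₀ t, f s l * duhamelKernel ε ψ k l (k * t) s‖ₑ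
      ≤ ∑ l ∈ ({k - 1, k + 1} : Finset ℤ),
        ∫⁻ s in S, forceKernel δ (|ε| / 2 * M) k l t s * ‖f s l‖ₑ := by
  by_cases hk : k = 0
  · simp [hk]
  rw [Finset.mul_sum]
  refine (enorm_sum_le _ _).trans (Finset.sum_le_sum fun l hl => ?_)
  rw [enorm_mul]
  calc _ ≤ ‖Complex.I * (k : ℂ) * W k‖ₑ *
        ∫⁻ s in Ioc T₀ t, ‖f s l * duhamelKernel ε ψ k l (k * t) s‖ₑ := by
        gcongr
        exact enorm_integral_le_lintegral_enorm _
    _ ≤ ∫⁻ s in Ioc T₀ t, ‖Complex.I * (k : ℂ) * W k‖ₑ *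
          ‖f s l * duhamelKernel ε ψ k l (k * t) s‖ₑ := lintegral_const_mul_le _ _
    _ ≤ _ := by
      rw [← lintegral_indicator measurableSet_Ioc, ← lintegral_indicator hS]
      refine lintegral_mono fun s => ?_
      by_cases hs : s ∈ Ioc T₀ t
      · have hb : ‖Complex.I * (k : ℂ) * W k‖ₑ * ‖f s l * duhamelKernel ε ψ k l (k * t) s‖ₑ
            ≤ forceKernel δ (|ε| / 2 * M) k l t s * ‖f s l‖ₑ := by
          rw [enorm_mul (f s l), mul_comm ‖f s l‖ₑ, ← mul_assoc]
          gcongr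
          exact enorm_force_multiplier_mul_duhamelKernel_le hW hψ hM ε hk l hs.2
        rw [indicator_of_mem hs]
        refine hb.trans ?_
        by_cases hd : |k * t - l * s| < δ
        · rw [indicator_of_mem (hres hk l hl s hs.1.le hs.2 hd)]
        · simp [forceKernel, band, hd]
      · rw [indicator_of_notMem hs]
        exact zero_le

theorem IsLVPSolution.enorm_force_sub_le (sol : IsLVPSolution W ε ψ T₀ h₀ h)
    (hW : ∀ k : ℤ, k ≠ 0 → ‖W k‖ = 1 / (k : ℝ) ^ 2) {δ M : ℝ}
    (hψ : Function.support (psiHat ψ) ⊆ Ioo (-δ) δ) (hM : ∀ ξ, ‖psiHat ψ ξ‖ ≤ M) {t : ℝ}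
    (ht : T₀ ≤ t) (k : ℤ) {S : Set ℝ} (hS : MeasurableSet S)
    (hres : k ≠ 0 → ∀ l ∈ ({k - 1, k + 1} : Finset ℤ), ∀ s, T₀ ≤ s → s ≤ t →
      |k * t - l * s| < δ → s ∈ S) :
    ‖(force W h t - force W (fun _ => h₀) t) k‖ₑ ≤ ∑ l ∈ ({k - 1, k + 1} : Finset ℤ),
      ∫⁻ s in S, forceKernel δ (|ε| / 2 * M) k l t s * ‖force W h s l‖ₑ := by
  have e : (force W h t - force W (fun _ => h₀) t) k = -(Complex.I * (k : ℂ) * W k *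
      ∑ l ∈ ({k - 1, k + 1} : Finset ℤ),
        ∫ s in Ioc T₀ t, force W h s l * duhamelKernel ε ψ k l (k * t) s) := by
    have := sol.sub_eq ht k (k * t)
    simp_rw [intervalIntegral.integral_of_le ht] at this
    rw [← mul_neg, ← this]
    simp only [Pi.sub_apply, force]
    ring
  rw [e, enorm_neg]
  exact enorm_multiplier_mul_sum_integral_le hW hψ hM ε T₀ _ t k hS hres

theorem IsLVPSolution.enorm_force_le_add (sol : IsLVPSolution W ε ψ T₀ h₀ h)
    (hW : ∀ k : ℤ, k ≠ 0 → ‖W k‖ = 1 / (k : ℝ) ^ 2) {δ M : ℝ}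
    (hψ : Function.support (psiHat ψ) ⊆ Ioo (-δ) δ) (hM : ∀ ξ, ‖psiHat ψ ξ‖ ≤ M) {t : ℝ}
    (ht : T₀ ≤ t) (k : ℤ) :
    ‖force W h t k‖ₑ ≤ ‖force W (fun _ => h₀) t k‖ₑ + ∑ l ∈ ({k - 1, k + 1} : Finset ℤ),
      ∫⁻ s in Ici T₀, forceKernel δ (|ε| / 2 * M) k l t s * ‖force W h s l‖ₑ := by
  have h1 := sol.enorm_force_sub_le hW hψ hM ht k measurableSet_Ici
    (fun _ _ _ s hs _ _ => hs)
  have h2 : force W h t k = force W (fun _ => h₀) t k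
      + (force W h t - force W (fun _ => h₀) t) k := by simp
  calc ‖force W h t k‖ₑ ≤ ‖force W (fun _ => h₀) t k‖ₑ
        + ‖(force W h t - force W (fun _ => h₀) t) k‖ₑ := by
        conv_lhs => rw [h2]
        exact enorm_add_le _ _
    _ ≤ _ := by gcongr

theorem ofReal_two_mul_div_abs_le_one {δ : ℝ} (hδ : 0 < δ) (hδ' : δ < 1 / 10) {l : ℤ} (hl : l ≠ 0) :
    ENNReal.ofReal (2 * (δ / |(l : ℝ)|)) ≤ 1 := by
  have h1 := one_le_abs_intCast hl
  rw [ENNReal.ofReal_le_one]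
  have : δ / |(l : ℝ)| ≤ δ := div_le_self hδ.le h1
  linarith

/-- Gevrey bound for the contribution of the force field on the set `S` of times to the
solution. -/
theorem gevreyEnergy_duhamel_le {δ M : ℝ} (hδ : 0 < δ) (hδ' : δ < 1 / 10)
    (hψ : Function.support (psiHat ψ) ⊆ Ioo (-δ) δ) (hM : ∀ ξ, ‖psiHat ψ ξ‖ ≤ M) (ε : ℝ)
    {S : Set ℝ} (hS : MeasurableSet S) {f : ℝ → ℤ → ℂ}
    (hf : ∀ l, AEStronglyMeasurable (fun t => f t l) (volume.restrict S))
    (hf0 : ∀ t, f t 0 = 0) {w : ℤ → ℝ → ℝ≥0∞} (hw : ∀ l, Measurable (w l)) {c : ℝ} {C : ℝ≥0∞}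
    (hC : ∀ k : ℤ, ∀ l ∈ ({k - 1, k + 1} : Finset ℤ), l ≠ 0 → ∀ η : ℝ, ∀ s ∈ S, |η - l * s| < δ →
      ENNReal.ofReal (Real.exp (c / 2 * |η| ^ (1 / 3 : ℝ)) * (|η - k * s| * (|ε| / 2 * M)))
        ≤ C * w l s) :
    gevreyEnergy c (fun k η => ∑ l ∈ ({k - 1, k + 1} : Finset ℤ),
      ∫ s in S, f s l * duhamelKernel ε ψ k l η s) ≤ 4 * C ^ 2 * weightedSq S w f := by
  have h1 := tsum_lintegral_kernel_sq_le (ν := fun _ => volume) hS hf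
    (P := (· ≠ 0)) (fun t l hl => by rw [not_not.1 hl, hf0]) hw
    (κ := fun k l η s => ENNReal.ofReal (Real.exp (c / 2 * |η| ^ (1 / 3 : ℝ)))
      * ‖duhamelKernel ε ψ k l η s‖ₑ)
    (a := fun _ l η s => C * band δ (η - l * s)) (p := fun _ _ => C) (q := fun _ _ => C)
    (D := C ^ 2) (fun k l => ?_) (fun k l hl hl0 => Eventually.of_forall fun η s hs => ?_)
    (fun k l hl hl0 η => ?_) (fun k l hl hl0 s => ?_) (fun k l _ _ => (sq C).ge)
  · refine le_trans (ENNReal.tsum_le_tsum fun k => lintegral_mono fun η => ?_) h1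
    rw [← ofReal_exp_half_sq, ← mul_pow, mul_comm]
    refine pow_le_pow_left' ?_ 2
    calc _ ≤ ENNReal.ofReal (Real.exp (c / 2 * |η| ^ (1 / 3 : ℝ))) *
          ∑ l ∈ ({k - 1, k + 1} : Finset ℤ), ∫⁻ s in S, ‖f s l * duhamelKernel ε ψ k l η s‖ₑ := by
          gcongr
          refine (enorm_sum_le _ _).trans (Finset.sum_le_sum fun l _ => ?_)
          exact enorm_integral_le_lintegral_enorm _
      _ ≤ _ := by
          rw [Finset.mul_sum]
          refine Finset.sum_le_sum fun l _ => ?_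
          refine (lintegral_const_mul_le _ _).trans (le_of_eq (lintegral_congr fun s => ?_))
          rw [enorm_mul]
          ring
  · exact ((measurable_band δ).comp (by fun_prop :
      Measurable fun x : ℝ × ℝ => x.1 - (l : ℝ) * x.2)).const_mul C
  · by_cases hd : |η - l * s| < δ
    · calc _ ≤ ENNReal.ofReal (Real.exp (c / 2 * |η| ^ (1 / 3 : ℝ))) *
            (ENNReal.ofReal (|η - k * s| * (|ε| / 2 * M)) * band δ (η - l * s)) := by
            gcongr
            exact enorm_duhamelKernel_le hψ hM ε k l η s
        _ = ENNReal.ofReal (Real.exp (c / 2 * |η| ^ (1 / 3 : ℝ)) * (|η - k * s| * (|ε| / 2 * M)))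
            * band δ (η - l * s) := by
            rw [ENNReal.ofReal_mul (Real.exp_pos _).le, mul_assoc]
        _ ≤ C * w l s * band δ (η - l * s) := by
            gcongr
            exact hC k l hl hl0 η s hs hd
        _ = _ := by ring
    · have h2 := enorm_duhamelKernel_le hψ hM ε k l η s
      have h3 : ‖duhamelKernel ε ψ k l η s‖ₑ = 0 := by simpa [band, hd] using h2
      simp [h3]
  · refine (setLIntegral_le_lintegral _ _).trans ?_
    rw [lintegral_const_mul _ (by fun_prop)]
    refine mul_le_of_le_one_right' ((lintegral_band_sub_mul_le (by exact_mod_cast hl0) η).trans ?_)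
    exact ofReal_two_mul_div_abs_le_one hδ hδ' hl0
  · rw [lintegral_const_mul _ (by fun_prop)]
    refine mul_le_of_le_one_right' ?_
    have h2 := lintegral_band_mul_sub_le (δ := δ) one_ne_zero (l * s)
    simp only [one_mul] at h2
    exact h2.trans (by simpa using ofReal_two_mul_div_abs_le_one hδ hδ' one_ne_zero)

theorem gevreyEnergy_congr_norm {c : ℝ} {g g' : ℤ → ℝ → ℂ} (hg : ∀ k η, ‖g k η‖ = ‖g' k η‖) :
    gevreyEnergy c g = gevreyEnergy c g' := by
  have : ∀ k η, ‖g k η‖ₑ = ‖g' k η‖ₑ := fun k η => by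
    rw [← ofReal_norm, ← ofReal_norm, hg]
  simp [gevreyEnergy, this]

theorem gevreyEnergy_mono {c c' : ℝ} (hc : c ≤ c') (g : ℤ → ℝ → ℂ) :
    gevreyEnergy c g ≤ gevreyEnergy c' g := by
  unfold gevreyEnergy
  gcongr

theorem gevreyEnergy_add_le {c : ℝ} {g g' : ℤ → ℝ → ℂ}
    (hg : ∀ k, AEStronglyMeasurable (g k) volume) :
    gevreyEnergy c (g + g') ≤ 2 * gevreyEnergy c g + 2 * gevreyEnergy c g' := by
  unfold gevreyEnergy
  rw [← ENNReal.tsum_mul_left, ← ENNReal.tsum_mul_left, ← ENNReal.tsum_add]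
  refine ENNReal.tsum_le_tsum fun k => ?_
  have hm : AEMeasurable
      (fun η => 2 * (‖g k η‖ₑ ^ 2 * ENNReal.ofReal (Real.exp (c * |η| ^ (1 / 3 : ℝ))))) volume :=
    (AEMeasurable.mul ((hg k).enorm.pow_const 2) (by fun_prop)).const_mul _
  rw [← lintegral_const_mul' _ _ (by norm_num), ← lintegral_const_mul' _ _ (by norm_num),
    ← lintegral_add_left' hm]
  refine lintegral_mono fun η => ?_
  rw [← mul_assoc, ← mul_assoc, ← add_mul]
  refine mul_le_mul_left ?_ _
  refine le_trans ?_ (ENNReal.add_sq_le_two_mul _ _)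
  gcongr
  exact enorm_add_le _ _

theorem fieldSq_add_le (F G : ℤ → ℂ) : fieldSq (F + G) ≤ 2 * fieldSq F + 2 * fieldSq G := by
  unfold fieldSq
  rw [← ENNReal.tsum_mul_left, ← ENNReal.tsum_mul_left, ← ENNReal.tsum_add]
  refine ENNReal.tsum_le_tsum fun k => le_trans ?_ (ENNReal.add_sq_le_two_mul _ _)
  gcongr
  exact enorm_add_le _ _

/-- Gevrey bound for the difference of the solution and its datum. -/
theorem IsLVPSolution.gevreyEnergy_sub_le (sol : IsLVPSolution W ε ψ T₀ h₀ h) {δ M : ℝ}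
    (hδ : 0 < δ) (hδ' : δ < 1 / 10) (hψ : Function.support (psiHat ψ) ⊆ Ioo (-δ) δ)
    (hM : ∀ ξ, ‖psiHat ψ ξ‖ ≤ M) {w : ℤ → ℝ → ℝ≥0∞} (hw : ∀ l, Measurable (w l)) {c : ℝ}
    {C : ℝ≥0∞} {t : ℝ} (ht : T₀ ≤ t)
    (hC : ∀ k : ℤ, ∀ l ∈ ({k - 1, k + 1} : Finset ℤ), l ≠ 0 → ∀ η : ℝ, ∀ s ∈ Ioc T₀ t,
      |η - l * s| < δ →
      ENNReal.ofReal (Real.exp (c / 2 * |η| ^ (1 / 3 : ℝ)) * (|η - k * s| * (|ε| / 2 * M)))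
        ≤ C * w l s) :
    gevreyEnergy c (h t - h₀) ≤ 4 * C ^ 2 * weightedSq (Ioc T₀ t) w (force W h) := by
  refine le_trans (le_of_eq (gevreyEnergy_congr_norm fun k η => ?_))
    (gevreyEnergy_duhamel_le hδ hδ' hψ hM ε measurableSet_Ioc
      (sol.aestronglyMeasurable (Ioc_subset_Icc_self.trans Icc_subset_Ici_self))
      (force_zero_mode W h) hw hC)
  rw [Pi.sub_apply, Pi.sub_apply, sol.sub_eq ht, norm_neg]
  simp_rw [intervalIntegral.integral_of_le ht]

end Solution

/-! ### Estimates on bounded time intervals and uniqueness -/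

theorem weightedSq_const_mul (S : Set ℝ) {C : ℝ≥0∞} (hC : C ≠ ∞) (w : ℤ → ℝ → ℝ≥0∞)
    (f : ℝ → ℤ → ℂ) : weightedSq S (fun k t => C * w k t) f = C ^ 2 * weightedSq S w f := by
  unfold weightedSq
  rw [← ENNReal.tsum_mul_left]
  refine tsum_congr fun k => ?_
  rw [← lintegral_const_mul' _ _ (ENNReal.pow_ne_top hC)]
  simp_rw [mul_assoc, mul_pow]

theorem weightedSq_ite (T₀ T : ℝ) (w : ℤ → ℝ → ℝ≥0∞) (f : ℝ → ℤ → ℂ) :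
    weightedSq (Ici T₀) (fun k t => if t ≤ T then w k t else 0) f
      = weightedSq (Icc T₀ T) w f := by
  unfold weightedSq
  refine tsum_congr fun k => ?_
  have : ∀ t, ((if t ≤ T then w k t else 0) * ‖f t k‖ₑ) ^ 2
      = (Iic T).indicator (fun t => (w k t * ‖f t k‖ₑ) ^ 2) t := fun t => by
    by_cases ht : t ≤ T <;> simp [ht]
  simp_rw [this]
  rw [setLIntegral_indicator measurableSet_Iic, inter_comm, Ici_inter_Iic]

/-- Removal of a truncation of the weights. -/
theorem weightedSq_le_of_truncations {S : Set ℝ} {f : ℝ → ℤ → ℂ}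
    (hf : ∀ l, AEStronglyMeasurable (fun t => f t l) (volume.restrict S))
    {v : ℕ → ℤ → ℝ → ℝ≥0∞} {w : ℤ → ℝ → ℝ≥0∞} (hv : ∀ N k, Measurable (v N k))
    (hmono : ∀ k t, Monotone fun N => v N k t) (hlim : ∀ k t, ∀ᶠ N in atTop, v N k t = w k t)
    {Y : ℝ≥0∞} (hY : ∀ N, weightedSq S (v N) f ≤ Y) : weightedSq S w f ≤ Y := by
  unfold weightedSq
  rw [ENNReal.tsum_eq_iSup_sum]
  refine iSup_le fun s => ?_
  have hlim' : Tendsto (fun N => ∑ k ∈ s, ∫⁻ t in S, (v N k t * ‖f t k‖ₑ) ^ 2) atTop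
      (𝓝 (∑ k ∈ s, ∫⁻ t in S, (w k t * ‖f t k‖ₑ) ^ 2)) := by
    refine tendsto_finsetSum _ fun k _ => ?_
    refine lintegral_tendsto_of_tendsto_of_monotone
      (fun N => ((hv N k).aemeasurable.mul (hf k).enorm).pow_const 2)
      (Eventually.of_forall fun t N N' hN => ?_) (Eventually.of_forall fun t => ?_)
    · have := hmono k t hN
      dsimp only at this ⊢
      gcongr
    · refine tendsto_const_nhds.congr' ?_
      filter_upwards [hlim k t] with N hN
      rw [hN]
  refine le_of_tendsto' hlim' fun N => le_trans ?_ (hY N)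
  exact ENNReal.sum_le_tsum s

/-- The convolution kernel `u e^{-r u}` on the half line. -/
def decayKernel (r u : ℝ) : ℝ≥0∞ := if 0 ≤ u then ENNReal.ofReal (u * Real.exp (-(r * u))) else 0

@[fun_prop]
theorem measurable_decayKernel (r : ℝ) : Measurable (decayKernel r) :=
  Measurable.ite measurableSet_Ici (by fun_prop) measurable_const

theorem lintegral_decayKernel {r : ℝ} (hr : 0 < r) :
    ∫⁻ u, decayKernel r u = ENNReal.ofReal (1 / r ^ 2) := by
  have h1 : ∫ u in Ioi (0 : ℝ), u * Real.exp (-(r * u)) = 1 / r ^ 2 := by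
    have h := Real.integral_rpow_mul_exp_neg_mul_Ioi (a := 2) (by norm_num) hr
    norm_num at h
    rw [h]
    simp
  have h2 : IntegrableOn (fun u => u * Real.exp (-(r * u))) (Ioi (0 : ℝ)) := by
    refine Integrable.of_integral_ne_zero ?_
    rw [h1]
    positivity
  have h3 : decayKernel r = (Ici (0 : ℝ)).indicator
      fun u => ENNReal.ofReal (u * Real.exp (-(r * u))) := by
    ext u
    by_cases hu : 0 ≤ u <;> simp [decayKernel, hu]
  rw [h3, lintegral_indicator measurableSet_Ici, setLIntegral_congr Ioi_ae_eq_Ici.symm, ← h1,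
    ofReal_integral_eq_lintegral_ofReal h2]
  filter_upwards [ae_restrict_mem measurableSet_Ioi] with u hu
  have : (0 : ℝ) < u := hu
  positivity

theorem lintegral_const_mul_decayKernel_sub_left {r B : ℝ} (hr : 0 < r) (hB : 0 ≤ B) (t : ℝ) :
    ∫⁻ s, ENNReal.ofReal B * decayKernel r (t - s) = ENNReal.ofReal (B / r ^ 2) := by
  rw [lintegral_const_mul _ (by fun_prop), lintegral_sub_left_eq_self (decayKernel r) t,
    lintegral_decayKernel hr, ← ENNReal.ofReal_mul hB, mul_one_div]

theorem lintegral_const_mul_decayKernel_sub_right {r B : ℝ} (hr : 0 < r) (hB : 0 ≤ B) (s : ℝ) :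
    ∫⁻ t, ENNReal.ofReal B * decayKernel r (t - s) = ENNReal.ofReal (B / r ^ 2) := by
  rw [lintegral_const_mul _ (by fun_prop), lintegral_sub_right_eq_self (decayKernel r) s,
    lintegral_decayKernel hr, ← ENNReal.ofReal_mul hB, mul_one_div]

theorem measurable_const_mul_decayKernel_sub (r B : ℝ) :
    Measurable (Function.uncurry fun t s => ENNReal.ofReal B * decayKernel r (t - s)) :=
  Measurable.const_mul (by fun_prop : Measurable fun x : ℝ × ℝ => decayKernel r (x.1 - x.2)) _

/-- The exponentially decaying weight in time. -/
def decayWeight (r T₀ t : ℝ) : ℝ≥0∞ := ENNReal.ofReal (Real.exp (-(r * (t - T₀))))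

@[fun_prop]
theorem measurable_decayWeight (r T₀ : ℝ) : Measurable (decayWeight r T₀) := by
  unfold decayWeight
  fun_prop

theorem decayWeight_le_one {r T₀ t : ℝ} (hr : 0 ≤ r) (ht : T₀ ≤ t) : decayWeight r T₀ t ≤ 1 := by
  rw [decayWeight, ENNReal.ofReal_le_one, Real.exp_le_one_iff]
  have : 0 ≤ r * (t - T₀) := mul_nonneg hr (by linarith)
  linarith

theorem one_le_exp_mul_decayWeight {r T₀ T t : ℝ} (hr : 0 ≤ r) (ht : t ≤ T) :
    1 ≤ ENNReal.ofReal (Real.exp (r * (T - T₀))) * decayWeight r T₀ t := by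
  rw [decayWeight, ← ENNReal.ofReal_mul (Real.exp_pos _).le, ← Real.exp_add, ENNReal.one_le_ofReal]
  refine Real.one_le_exp ?_
  have : 0 ≤ r * (T - t) := mul_nonneg hr (by linarith)
  linarith

theorem decayWeight_mul_forceKernel_le (r T₀ δ : ℝ) {A : ℝ} (hA : 0 ≤ A) (k l : ℤ) (t s : ℝ) :
    decayWeight r T₀ t * forceKernel δ A k l t s
      ≤ ENNReal.ofReal A * decayKernel r (t - s) * decayWeight r T₀ s := by
  by_cases hcond : k ≠ 0 ∧ s ≤ t
  swap
  · simp [forceKernel, if_neg hcond]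
  have hst := sub_nonneg.2 hcond.2
  rw [forceKernel, if_pos hcond, decayKernel, if_pos hst]
  calc _ ≤ decayWeight r T₀ t * (ENNReal.ofReal ((t - s) * A) * 1) := by
        gcongr
        exact band_le_one _ _
    _ = _ := by
      unfold decayWeight
      rw [mul_one, ← ENNReal.ofReal_mul (Real.exp_pos _).le, ← ENNReal.ofReal_mul hA,
        ← ENNReal.ofReal_mul (mul_nonneg hA (mul_nonneg hst (Real.exp_pos _).le))]
      congr 1
      have : Real.exp (-(r * (t - T₀)))
          = Real.exp (-(r * (t - s))) * Real.exp (-(r * (s - T₀))) := by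
        rw [← Real.exp_add]
        congr 1
        ring
      rw [this]
      ring

theorem ofReal_mul_self_le_inv_sixteen {x : ℝ} (hx : 0 ≤ x) (hx' : x ≤ 1 / 4) :
    ENNReal.ofReal x * ENNReal.ofReal x ≤ 16⁻¹ := by
  rw [← ENNReal.ofReal_mul hx]
  have : (16⁻¹ : ℝ≥0∞) = ENNReal.ofReal (16⁻¹) := by
    rw [ENNReal.ofReal_inv_of_pos (by norm_num)]
    norm_num
  rw [this]
  refine ENNReal.ofReal_le_ofReal ?_
  nlinarith

/-- The Gevrey weight along the line `η = k t`, for amplitudes. -/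
def gevreyWeight (c : ℝ) (k : ℤ) (t : ℝ) : ℝ≥0∞ :=
  ENNReal.ofReal (Real.exp (c / 2 * |(k : ℝ) * t| ^ (1 / 3 : ℝ)))

@[fun_prop]
theorem measurable_gevreyWeight (c : ℝ) (k : ℤ) : Measurable (gevreyWeight c k) := by
  unfold gevreyWeight
  fun_prop

theorem one_le_gevreyWeight {c : ℝ} (hc : 0 ≤ c) (k : ℤ) (t : ℝ) : 1 ≤ gevreyWeight c k t := by
  rw [gevreyWeight, ENNReal.one_le_ofReal]
  exact Real.one_le_exp (by positivity)

theorem exp_cbrt_le {c : ℝ} (hc : 0 ≤ c) {δ : ℝ} (hδ : 0 < δ) (hδ' : δ < 1 / 10) {x y : ℝ}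
    (h : |x - y| < δ) : Real.exp (c / 2 * |x| ^ (1 / 3 : ℝ))
      ≤ Real.exp (c / 2) * Real.exp (c / 2 * |y| ^ (1 / 3 : ℝ)) := by
  rw [← Real.exp_add]
  refine Real.exp_le_exp.2 ?_
  have h1 := cbrt_le_add_of_abs_sub_le h.le
  have h2 : δ ^ (1 / 3 : ℝ) ≤ 1 := Real.rpow_le_one hδ.le (by linarith) (by norm_num)
  nlinarith

/-- Estimate on bounded time intervals: the weights `e^{-r t}` with large `r` turn the Volterra
operator into a contraction, and resonance preserves the Gevrey weights up to a factor. -/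
theorem exists_weightedSq_Icc_le {δ : ℝ} (hδ : 0 < δ) (hδ' : δ < 1 / 10) {A : ℝ} (hA : 0 ≤ A)
    {c : ℝ} (hc : 0 ≤ c) (T₀ T : ℝ) : ∃ C : ℝ≥0, ∀ f f₀ : ℝ → ℤ → ℂ,
      (∀ l, AEStronglyMeasurable (fun t => f t l) (volume.restrict (Ici T₀))) →
      (∀ t, f t 0 = 0) →
      (∀ t, T₀ ≤ t → ∀ k, ‖f t k‖ₑ ≤ ‖f₀ t k‖ₑ
        + ∑ l ∈ ({k - 1, k + 1} : Finset ℤ), ∫⁻ s in Ici T₀, forceKernel δ A k l t s * ‖f s l‖ₑ) →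
      weightedSq (Icc T₀ T) (fun _ _ => 1) f < ∞ →
      weightedSq (Icc T₀ T) (gevreyWeight c) f
        ≤ C * weightedSq (Icc T₀ T) (gevreyWeight c) f₀ := by
  set D := Real.exp (c / 2) with hD
  have hD0 : 0 < D := Real.exp_pos _
  have hD1 : 1 ≤ D := Real.one_le_exp (by linarith)
  set r := 4 * (A * D) + 1 with hr
  have hr1 : 1 ≤ r := by have : 0 ≤ A * D := by positivity
                         linarith
  have hr0 : 0 < r := by linarith
  refine ⟨(Real.exp (r * (T - T₀))).toNNReal ^ 2 * 4, fun f f₀ hf hf0 hle hfin => ?_⟩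
  let v : ℕ → ℤ → ℝ → ℝ≥0∞ := fun N k t => min (gevreyWeight c k t) N
  have hvm : ∀ N k, Measurable (v N k) := fun N k => by fun_prop
  have hV : ∀ N, weightedSq (Icc T₀ T) (fun k t => decayWeight r T₀ t * v N k t) f
      ≤ 4 * weightedSq (Icc T₀ T) (fun k t => decayWeight r T₀ t * v N k t) f₀ := by
    intro N
    rw [← weightedSq_ite, ← weightedSq_ite]
    refine weightedSq_le_of_volterra hf hf0 hle (fun l => Measurable.ite measurableSet_Iic
      ((measurable_decayWeight r T₀).mul (hvm N l)) measurable_const)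
      (fun _ _ => measurable_const_mul_decayKernel_sub r (A * D))
      (fun k l hl hl0 t ht s hs => ?_)
      (fun _ _ _ _ t => (lintegral_const_mul_decayKernel_sub_left hr0 (by positivity) t).le)
      (fun _ _ _ _ s => (lintegral_const_mul_decayKernel_sub_right hr0 (by positivity) s).le)
      (fun _ _ _ _ => ofReal_mul_self_le_inv_sixteen (by positivity) ?_) ?_
    · by_cases hcond : s ≤ t ∧ |k * t - l * s| < δ
      swap
      · have : forceKernel δ A k l t s = 0 := by
          unfold forceKernel band
          split_ifs with h1 h2 <;> simp_all
        simp [this]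
      obtain ⟨hst, hd⟩ := hcond
      by_cases htT : t ≤ T
      swap
      · simp [htT]
      rw [if_pos htT, if_pos (hst.trans htT)]
      have hv : v N k t ≤ ENNReal.ofReal D * v N l s := by
        have h1 : gevreyWeight c k t ≤ ENNReal.ofReal D * gevreyWeight c l s := by
          unfold gevreyWeight
          rw [← ENNReal.ofReal_mul hD0.le]
          exact ENNReal.ofReal_le_ofReal (exp_cbrt_le hc hδ hδ' hd)
        have h2 : (N : ℝ≥0∞) ≤ ENNReal.ofReal D * N := by
          conv_lhs => rw [← one_mul (N : ℝ≥0∞)]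
          gcongr
          rwa [ENNReal.one_le_ofReal]
        simp only [v]
        rw [mul_min]
        exact min_le_min h1 h2
      calc decayWeight r T₀ t * v N k t * forceKernel δ A k l t s
          = decayWeight r T₀ t * forceKernel δ A k l t s * v N k t := by ring
        _ ≤ ENNReal.ofReal A * decayKernel r (t - s) * decayWeight r T₀ s
            * (ENNReal.ofReal D * v N l s) :=
            mul_le_mul' (decayWeight_mul_forceKernel_le r T₀ δ hA k l t s) hv
        _ = _ := by
          rw [ENNReal.ofReal_mul hA]
          ring
    · rw [div_le_iff₀ (by positivity)]
      nlinarith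
    · rw [weightedSq_ite]
      refine lt_of_le_of_lt (weightedSq_mono_weight (w' := fun _ _ => N * 1) measurableSet_Icc hf0
        fun k _ t ht => ?_) ?_
      · rw [mul_one]
        exact mul_le_of_le_one_of_le (decayWeight_le_one hr0.le ht.1) (min_le_right _ _)
      · rw [weightedSq_const_mul _ (by simp)]
        exact ENNReal.mul_lt_top (by simp) hfin
  refine weightedSq_le_of_truncations (v := v)
    (fun l => (hf l).mono_measure (Measure.restrict_mono Icc_subset_Ici_self le_rfl)) hvm
    (fun k t N N' hN => by
      simp only [v]
      gcongr)
    (fun k t => ?_) fun N => ?_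
  · obtain ⟨N₀, hN₀⟩ := ENNReal.exists_nat_gt
      (show gevreyWeight c k t ≠ ∞ from ENNReal.ofReal_ne_top)
    filter_upwards [eventually_ge_atTop N₀] with N hN
    exact min_eq_left (hN₀.le.trans (by exact_mod_cast hN))
  · set E := ENNReal.ofReal (Real.exp (r * (T - T₀))) with hE
    have hf0' : weightedSq (Icc T₀ T) (v N) f
        ≤ weightedSq (Icc T₀ T) (fun k t => E * (decayWeight r T₀ t * v N k t)) f := by
      refine weightedSq_mono_weight measurableSet_Icc hf0 fun k _ t ht => ?_
      rw [← mul_assoc]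
      exact le_mul_of_one_le_left' (one_le_exp_mul_decayWeight hr0.le ht.2)
    have hf₀ : weightedSq (Icc T₀ T) (fun k t => decayWeight r T₀ t * v N k t) f₀
        ≤ weightedSq (Icc T₀ T) (gevreyWeight c) f₀ := by
      refine ENNReal.tsum_le_tsum fun k => setLIntegral_mono_ae' measurableSet_Icc
        (Eventually.of_forall fun t ht => ?_)
      gcongr
      exact mul_le_of_le_one_of_le (decayWeight_le_one hr0.le ht.1) (min_le_left _ _)
    rw [weightedSq_const_mul _ ENNReal.ofReal_ne_top] at hf0'
    calc _ ≤ E ^ 2 * (4 * weightedSq (Icc T₀ T) (gevreyWeight c) f₀) := by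
          refine hf0'.trans ?_
          gcongr
          refine (hV N).trans ?_
          gcongr
      _ = _ := by
        push_cast
        rw [hE, ENNReal.ofReal]
        ring

section Solution

variable {W : ℤ → ℂ} {δ : ℝ} {ψ : 𝓢(ℝ, ℂ)}

theorem abs_sub_mul_le_of_neighbor {k l : ℤ} (hl : l ∈ ({k - 1, k + 1} : Finset ℤ)) {η s δ : ℝ}
    (hs : 0 ≤ s) (hd : |η - l * s| < δ) : |η - k * s| ≤ δ + s := by
  rw [abs_lt] at hd
  rcases mem_neighbors.1 hl with rfl | rfl <;> push_cast at hd <;> rw [abs_le] <;>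
    constructor <;> nlinarith

/-- On bounded time intervals there is no loss in the Gevrey exponent, neither for the force field
nor for the solution. -/
theorem exists_gevreyEnergy_Icc_le (hW : ∀ k : ℤ, k ≠ 0 → ‖W k‖ = 1 / (k : ℝ) ^ 2)
    (hδ : 0 < δ) (hδ' : δ < 1 / 10) (hψ : Function.support (psiHat ψ) ⊆ Ioo (-δ) δ)
    (ε : ℝ) {c : ℝ} (hc : 0 ≤ c) {T₀ : ℝ} (hT₀ : 0 ≤ T₀) (T : ℝ) :
    ∃ C : ℝ≥0, ∀ (h₀ : ℤ → ℝ → ℂ) (h : ℝ → ℤ → ℝ → ℂ),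
      (∀ k, AEStronglyMeasurable (h₀ k) volume) → IsLVPSolution W ε ψ T₀ h₀ h →
      weightedSq (Icc T₀ T) (gevreyWeight c) (force W h) ≤ C * gevreyEnergy c h₀ ∧
      ∀ t ∈ Icc T₀ T, gevreyEnergy c (h t) ≤ C * gevreyEnergy c h₀ := by
  obtain ⟨M, hM0, hM⟩ := exists_norm_psiHat_le ψ
  have hA : 0 ≤ |ε| / 2 * M := by positivity
  obtain ⟨C, hC⟩ := exists_weightedSq_Icc_le hδ hδ' hA hc T₀ T
  set B : ℝ := Real.exp (c / 2) * ((1 + |T|) * (|ε| / 2 * M)) with hB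
  have hB0 : 0 ≤ B := by positivity
  have hforce : ∀ (h₀ : ℤ → ℝ → ℂ) (h : ℝ → ℤ → ℝ → ℂ), IsLVPSolution W ε ψ T₀ h₀ h →
      weightedSq (Icc T₀ T) (gevreyWeight c) (force W h) ≤ C * gevreyEnergy c h₀ := by
    intro h₀ h sol
    refine (hC _ _ sol.force_measurable (force_zero_mode W h)
      (fun t ht k => sol.enorm_force_le_add hW hψ hM ht k) (sol.weightedSq_one_lt_top T)).trans ?_
    gcongr
    exact weightedSq_freeTransport_le hW measurableSet_Icc (fun _ _ _ _ => le_rfl) h₀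
  refine ⟨C + (2 + 2 * (4 * B.toNNReal ^ 2 * C)), fun h₀ h hm sol => ⟨?_, fun t ht => ?_⟩⟩
  · refine (hforce h₀ h sol).trans ?_
    gcongr
    exact le_self_add
  · have h1 := sol.gevreyEnergy_sub_le (c := c) (C := B.toNNReal) hδ hδ' hψ hM
      (measurable_gevreyWeight c) ht.1 fun k l hl hl0 η s hs hd => by
        change _ ≤ ENNReal.ofReal B * _
        unfold gevreyWeight
        rw [← ENNReal.ofReal_mul hB0]
        refine ENNReal.ofReal_le_ofReal ?_
        have hs0 : 0 ≤ s := hT₀.trans hs.1.le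
        have h2 := abs_sub_mul_le_of_neighbor hl hs0 hd
        have h3 : s ≤ |T| := (hs.2.trans ht.2).trans (le_abs_self T)
        calc _ ≤ Real.exp (c / 2) * Real.exp (c / 2 * |l * s| ^ (1 / 3 : ℝ))
              * ((1 + |T|) * (|ε| / 2 * M)) := by
              gcongr
              · exact exp_cbrt_le hc hδ hδ' hd
              · linarith
          _ = _ := by rw [hB]; ring
    have h2 : h t = h₀ + (h t - h₀) := by abel
    rw [h2]
    refine (gevreyEnergy_add_le hm).trans ?_
    calc _ ≤ 2 * gevreyEnergy c h₀
          + 2 * (4 * (B.toNNReal : ℝ≥0∞) ^ 2 * (C * gevreyEnergy c h₀)) := by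
          gcongr
          refine h1.trans ?_
          gcongr
          refine (weightedSq_mono_set ?_ _ _).trans (hforce h₀ h sol)
          exact Ioc_subset_Icc_self.trans (Icc_subset_Icc_right ht.2)
      _ = ((2 + 2 * (4 * B.toNNReal ^ 2 * C) : ℝ≥0) : ℝ≥0∞) * gevreyEnergy c h₀ := by
          push_cast
          ring
      _ ≤ _ := mul_le_mul_left (ENNReal.coe_le_coe.2 le_add_self) _

theorem force_sub (W : ℤ → ℂ) (h h' : ℝ → ℤ → ℝ → ℂ) :
    force W (h - h') = force W h - force W h' := by
  ext t k
  simp [force, mul_sub]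

theorem fieldSq_neg (F : ℤ → ℂ) : fieldSq (-F) = fieldSq F := by simp [fieldSq]

/-- The equation is linear. -/
theorem IsLVPSolution.sub {ε T₀ : ℝ} {h₀ h₀' : ℤ → ℝ → ℂ} {h h' : ℝ → ℤ → ℝ → ℂ}
    (sol : IsLVPSolution W ε ψ T₀ h₀ h) (sol' : IsLVPSolution W ε ψ T₀ h₀' h') :
    IsLVPSolution W ε ψ T₀ (h₀ - h₀') (h - h') where
  force_measurable l := by
    rw [force_sub]
    exact (sol.force_measurable l).sub (sol'.force_measurable l)
  force_sq_integrable T := by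
    rw [force_sub]
    have hm : ∀ l, AEMeasurable (fun t => ‖force W h t l‖ₑ ^ 2)
        (volume.restrict (Icc T₀ T)) := fun l =>
      (sol.aestronglyMeasurable Icc_subset_Ici_self l).enorm.pow_const 2
    have hm2 : AEMeasurable (fun t => 2 * fieldSq (force W h t)) (volume.restrict (Icc T₀ T)) :=
      (AEMeasurable.tsum hm).const_mul _
    calc ∫⁻ t in Icc T₀ T, fieldSq ((force W h - force W h') t)
        ≤ ∫⁻ t in Icc T₀ T, (2 * fieldSq (force W h t) + 2 * fieldSq (force W h' t)) := by
          refine lintegral_mono fun t => ?_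
          rw [Pi.sub_apply, sub_eq_add_neg, ← fieldSq_neg (force W h' t)]
          exact fieldSq_add_le _ _
      _ = 2 * (∫⁻ t in Icc T₀ T, fieldSq (force W h t))
          + 2 * ∫⁻ t in Icc T₀ T, fieldSq (force W h' t) := by
          rw [lintegral_add_left' hm2, lintegral_const_mul' _ _ (by norm_num),
            lintegral_const_mul' _ _ (by norm_num)]
      _ < ∞ := ENNReal.add_lt_top.2
          ⟨ENNReal.mul_lt_top (by norm_num) (sol.force_sq_integrable T),
            ENNReal.mul_lt_top (by norm_num) (sol'.force_sq_integrable T)⟩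
  duhamel t ht k η := by
    have e : ∀ l, ∫ s in T₀..t, force W (h - h') s l * duhamelKernel ε ψ k l η s
        = (∫ s in T₀..t, force W h s l * duhamelKernel ε ψ k l η s)
          - ∫ s in T₀..t, force W h' s l * duhamelKernel ε ψ k l η s := by
      intro l
      rw [← intervalIntegral.integral_sub (sol.intervalIntegrable le_rfl ht k l η)
        (sol'.intervalIntegrable le_rfl ht k l η)]
      simp [force_sub, sub_mul]
    change h t k η - h' t k η = h₀ k η - h₀' k η - ∑ l ∈ ({k - 1, k + 1} : Finset ℤ),
      ∫ s in T₀..t, force W (h - h') s l * duhamelKernel ε ψ k l η s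
    simp_rw [e]
    rw [Finset.sum_sub_distrib]
    linear_combination sol.sub_eq ht k η - sol'.sub_eq ht k η

/-- The difference of two solutions solves the problem with datum zero, so that its force field
vanishes. -/
theorem IsLVPSolution.unique {ε T₀ : ℝ} {h₀ : ℤ → ℝ → ℂ} {h h' : ℝ → ℤ → ℝ → ℂ}
    (hW : ∀ k : ℤ, k ≠ 0 → ‖W k‖ = 1 / (k : ℝ) ^ 2) (hδ : 0 < δ) (hδ' : δ < 1 / 10)
    (hψ : Function.support (psiHat ψ) ⊆ Ioo (-δ) δ) (hT₀ : 0 ≤ T₀)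
    (sol : IsLVPSolution W ε ψ T₀ h₀ h) (sol' : IsLVPSolution W ε ψ T₀ h₀ h') {t : ℝ}
    (ht : T₀ ≤ t) : h t = h' t := by
  have hsub := sol.sub sol'
  rw [sub_self] at hsub
  obtain ⟨C, hC⟩ := exists_gevreyEnergy_Icc_le hW hδ hδ' hψ ε le_rfl hT₀ t
  have h1 := (hC 0 _ (fun k => aestronglyMeasurable_const) hsub).1
  have h0 : gevreyEnergy 0 (0 : ℤ → ℝ → ℂ) = 0 := by simp [gevreyEnergy]
  rw [h0, mul_zero, nonpos_iff_eq_zero, weightedSq, ENNReal.tsum_eq_zero] at h1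
  ext k η
  have h2 := hsub.duhamel t ht k η
  have h3 : ∀ l, ∫ s in T₀..t, force W (h - h') s l *
      (Complex.I * ((η - k * s : ℝ) : ℂ) * ((ε / 2 : ℝ) : ℂ) * psiHat ψ (η - l * s)) = 0 := by
    intro l
    rw [intervalIntegral.integral_of_le ht]
    refine integral_eq_zero_of_ae ?_
    have h4 := (lintegral_eq_zero_iff' (((measurable_gevreyWeight 0 l).aemeasurable.mul
      (hsub.aestronglyMeasurable Icc_subset_Ici_self l).enorm).pow_const 2)).1 (h1 l)
    filter_upwards [ae_restrict_of_ae_restrict_of_subset Ioc_subset_Icc_self h4] with s hs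
    have h5 : force W (h - h') s l = 0 := by
      have : gevreyWeight 0 l s = 1 := by simp [gevreyWeight]
      simpa [this] using hs
    simp [h5]
  simp only [h3, Finset.sum_const_zero, sub_zero] at h2
  exact sub_eq_zero.1 h2

end Solution

/-! ### Echo chains -/

/-- The weight that decreases along echo chains. An echo carries mode `n + 1` at time `s` to mode
`n` at time `t ≈ (n + 1) s / n`; the quantity `n (t + δ)` does not increase in this step, although
the frequency `n t` may increase by up to `δ`. The cubed partial sum compensates the amplification
by the echo. -/
def chainWeight (δ b : ℝ) (n : ℕ) (t : ℝ) : ℝ :=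
  Real.exp (6 / 10 * (n * (t + δ)) ^ (1 / 3 : ℝ)) *
    expPartial n (b * (n * (t + δ)) ^ (1 / 3 : ℝ)) ^ 3

@[fun_prop]
theorem measurable_chainWeight (δ b : ℝ) (n : ℕ) : Measurable (chainWeight δ b n) := by
  have := measurable_expPartial n
  unfold chainWeight
  fun_prop

theorem chainWeight_le_exp {δ b : ℝ} (hδ : 0 < δ) (hb : 0 ≤ b) (n : ℕ) {t : ℝ} (ht : 0 ≤ t) :
    chainWeight δ b n t ≤ Real.exp ((6 / 10 + 3 * b) * (n * (t + δ)) ^ (1 / 3 : ℝ)) := by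
  set z := (n * (t + δ)) ^ (1 / 3 : ℝ) with hz
  have hz0 : 0 ≤ z := by positivity
  calc chainWeight δ b n t ≤ Real.exp (6 / 10 * z) * Real.exp (b * z) ^ 3 := by
        unfold chainWeight
        have := expPartial_nonneg (mul_nonneg hb hz0) n
        gcongr
        exact expPartial_le_exp (mul_nonneg hb hz0) n
    _ = _ := by
      rw [← Real.exp_nat_mul, ← Real.exp_add]
      congr 1
      push_cast
      ring

theorem exp_le_chainWeight {δ b : ℝ} (hδ : 0 < δ) (hb : 0 ≤ b) {n : ℕ} (hn : n ≠ 0) {t : ℝ}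
    (ht : 0 ≤ t) : Real.exp (6 / 10 * (n * t) ^ (1 / 3 : ℝ)) ≤ chainWeight δ b n t := by
  set z := (n * (t + δ)) ^ (1 / 3 : ℝ) with hz
  have hz0 : 0 ≤ z := by positivity
  calc _ ≤ Real.exp (6 / 10 * z) := by
        rw [hz]
        gcongr
        linarith
    _ ≤ _ := by
        unfold chainWeight
        exact le_mul_of_one_le_right (Real.exp_pos _).le
          (one_le_pow₀ (one_le_expPartial (mul_nonneg hb hz0) hn))

/-- From time `100` on the shift by `δ` costs less than a factor `1.1 ^ 3` in frequency. -/
theorem chainWeight_le_exp_half {δ b c : ℝ} (hδ : 0 < δ) (hδ' : δ < 1 / 10) (hb : 0 ≤ b)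
    (hc : 132 / 100 + 66 / 10 * b ≤ c) (n : ℕ) {t : ℝ} (ht : 100 ≤ t) :
    chainWeight δ b n t ≤ Real.exp (c / 2 * (n * t) ^ (1 / 3 : ℝ)) := by
  refine (chainWeight_le_exp hδ hb n (by linarith)).trans (Real.exp_le_exp.2 ?_)
  have h1 : (n * (t + δ)) ^ (1 / 3 : ℝ) ≤ 11 / 10 * (n * t) ^ (1 / 3 : ℝ) := by
    have h2 : (11 / 10 : ℝ) = ((11 / 10) ^ (3 : ℕ)) ^ (1 / 3 : ℝ) := by
      rw [← Real.rpow_natCast, ← Real.rpow_mul (by norm_num)]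
      norm_num
    rw [h2, ← Real.mul_rpow (by positivity) (by positivity)]
    refine Real.rpow_le_rpow (by positivity) ?_ (by norm_num)
    have : (0 : ℝ) ≤ n := by positivity
    nlinarith
  have h3 : 0 ≤ (n * t) ^ (1 / 3 : ℝ) := by positivity
  calc _ ≤ (6 / 10 + 3 * b) * (11 / 10 * (n * t) ^ (1 / 3 : ℝ)) := by gcongr
    _ ≤ _ := by nlinarith

/-- One step of an echo chain: up to the factor `n / 2`, which the width of the resonance
compensates, the weight absorbs the kernel `(t - s) A` of the Volterra equation. -/
theorem chainWeight_mul_le {δ b A : ℝ} (hδ : 0 < δ) (hb : 0 ≤ b) (hA : 0 ≤ A)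
    (hAb : 2 * A ≤ b ^ 3) {n : ℕ} (hn : n ≠ 0) {s t : ℝ} (hs : 0 ≤ s) (hst : s ≤ t)
    (hd : n * t - (n + 1 : ℕ) * s < δ) :
    chainWeight δ b n t * ((t - s) * A) ≤ n / 2 * chainWeight δ b (n + 1) s := by
  set z := (n * (t + δ)) ^ (1 / 3 : ℝ) with hz
  set z' := ((n + 1 : ℕ) * (s + δ)) ^ (1 / 3 : ℝ) with hz'
  have hn1 : (1 : ℝ) ≤ n := by exact_mod_cast Nat.one_le_iff_ne_zero.2 hn
  have hn0 : (0 : ℝ) < n := by linarith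
  have ht : 0 ≤ t := hs.trans hst
  have hz0 : 0 ≤ z := by positivity
  have hzz : z ≤ z' := by
    refine Real.rpow_le_rpow (by positivity) ?_ (by norm_num)
    push_cast at hd ⊢
    nlinarith
  have hz3 : (t - s) ≤ z ^ 3 / n ^ 2 := by
    rw [hz, cbrt_pow_three (by positivity), le_div_iff₀ (by positivity)]
    push_cast at hd
    have h1 : (n + 1) * (t - s) ≤ t + δ := by nlinarith
    have h2 : n * ((n + 1) * (t - s)) ≤ n * (t + δ) := by gcongr
    nlinarith
  have he0 := expPartial_nonneg (mul_nonneg hb hz0) n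
  calc chainWeight δ b n t * ((t - s) * A)
      ≤ Real.exp (6 / 10 * z) * expPartial n (b * z) ^ 3 * (z ^ 3 / n ^ 2 * (b ^ 3 / 2)) := by
        unfold chainWeight
        rw [← hz]
        gcongr
        linarith
    _ = n / 2 * (Real.exp (6 / 10 * z) * (b * z / n * expPartial n (b * z)) ^ 3) := by
        field_simp
    _ ≤ n / 2 * (Real.exp (6 / 10 * z') * expPartial (n + 1) (b * z') ^ 3) := by
        have h4 : b * z / n * expPartial n (b * z) ≤ expPartial (n + 1) (b * z') :=
          (div_mul_expPartial_le (mul_nonneg hb hz0) hn).trans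
            (expPartial_mono (mul_nonneg hb hz0) (by gcongr) _)
        gcongr

/-- For times at least `100` a mode resonates only with its neighbour that is farther away from
zero. -/
theorem natAbs_eq_of_resonance {δ : ℝ} (hδ' : δ < 1 / 10) {k l : ℤ} (hk : k ≠ 0)
    (hl : l ∈ ({k - 1, k + 1} : Finset ℤ)) {s t : ℝ} (hs : 100 ≤ s) (hst : s ≤ t)
    (hd : |k * t - l * s| < δ) :
    l.natAbs = k.natAbs + 1 ∧ |(k.natAbs : ℝ) * t - (l.natAbs : ℕ) * s| < δ := by
  rw [abs_lt] at hd
  rcases lt_or_gt_of_ne hk with hk | hk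
  · have hk' : (k : ℝ) ≤ -1 := by exact_mod_cast Int.le_sub_one_of_lt hk
    rcases mem_neighbors.1 hl with rfl | rfl
    · refine ⟨by omega, ?_⟩
      have e1 : ((k.natAbs : ℕ) : ℝ) = -k := by
        rw [Nat.cast_natAbs, abs_of_neg hk]
        simp
      have e2 : (((k - 1).natAbs : ℕ) : ℝ) = -(k - 1) := by
        rw [Nat.cast_natAbs, abs_of_neg (by omega)]
        push_cast
        ring
      rw [e1, e2, abs_lt]
      push_cast at hd
      constructor <;> linarith [hd.1, hd.2]
    · exfalso
      push_cast at hd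
      nlinarith [hd.1, hd.2]
  · have hk' : (1 : ℝ) ≤ k := by exact_mod_cast hk
    rcases mem_neighbors.1 hl with rfl | rfl
    · exfalso
      push_cast at hd
      nlinarith [hd.1, hd.2]
    · refine ⟨by omega, ?_⟩
      have e1 : ((k.natAbs : ℕ) : ℝ) = k := by
        rw [Nat.cast_natAbs, abs_of_pos hk]
      have e2 : (((k + 1).natAbs : ℕ) : ℝ) = k + 1 := by
        rw [Nat.cast_natAbs, abs_of_pos (by omega)]
        push_cast
        ring
      rw [e1, e2, abs_lt]
      push_cast at hd
      constructor <;> linarith [hd.1, hd.2]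

theorem natAbs_mul_eq_abs (k : ℤ) {t : ℝ} (ht : 0 ≤ t) : (k.natAbs : ℝ) * t = |(k : ℝ) * t| := by
  rw [abs_mul, abs_of_nonneg ht, Nat.cast_natAbs]
  push_cast
  rfl

/-- The estimate of the echo chains. The regions `|k| (t - δ) ≤ N` are invariant under the step
from a mode to the one that drives it, and in each of them the weight is bounded. -/
theorem weightedSq_chainWeight_le {δ : ℝ} (hδ : 0 < δ) (hδ' : δ < 1 / 10) {b A : ℝ} (hb : 0 ≤ b)
    (hA : 0 ≤ A) (hAb : 2 * A ≤ b ^ 3) {f f₀ : ℝ → ℤ → ℂ}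
    (hf : ∀ l, AEStronglyMeasurable (fun t => f t l) (volume.restrict (Ici 100)))
    (hf0 : ∀ t, f t 0 = 0)
    (hle : ∀ t, 100 ≤ t → ∀ k, ‖f t k‖ₑ ≤ ‖f₀ t k‖ₑ
      + ∑ l ∈ ({k - 1, k + 1} : Finset ℤ), ∫⁻ s in Ici 100, forceKernel δ A k l t s * ‖f s l‖ₑ)
    (hfin : ∀ T, weightedSq (Icc 100 T) (fun _ _ => 1) f < ∞) :
    weightedSq (Ici 100) (fun k t => ENNReal.ofReal (chainWeight δ b k.natAbs t)) f
      ≤ 4 * weightedSq (Ici 100) (fun k t => ENNReal.ofReal (chainWeight δ b k.natAbs t)) f₀ := by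
  let v : ℕ → ℤ → ℝ → ℝ≥0∞ := fun N k t =>
    if k.natAbs * (t - δ) ≤ N then ENNReal.ofReal (chainWeight δ b k.natAbs t) else 0
  have hvm : ∀ N k, Measurable (v N k) := fun N k =>
    Measurable.ite (measurableSet_le (by fun_prop) measurable_const) (by fun_prop) measurable_const
  refine weightedSq_le_of_truncations (v := v) hf hvm (fun k t N N' hN => ?_) (fun k t => ?_)
    fun N => ?_
  · simp only [v]
    split_ifs with h1 h2
    · exact le_rfl
    · exact absurd (h1.trans (by exact_mod_cast hN)) h2
    · exact zero_le
    · exact le_rfl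
  · obtain ⟨N₀, hN₀⟩ := exists_nat_ge (k.natAbs * (t - δ))
    filter_upwards [eventually_ge_atTop N₀] with N hN
    exact if_pos (hN₀.trans (by exact_mod_cast hN))
  refine (weightedSq_le_of_volterra (w := v N) hf hf0 hle (hvm N)
    (a := fun k l t s => if l.natAbs = k.natAbs + 1 then
      ENNReal.ofReal (k.natAbs / 2) * band δ (k * t - l * s) else 0)
    (p := fun _ _ => ENNReal.ofReal (1 / 4)) (q := fun _ _ => ENNReal.ofReal (1 / 4))
    (fun k l => ?_) (fun k l hl hl0 t ht s hs => ?_) (fun k l hl hl0 t => ?_)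
    (fun k l hl hl0 s => ?_) (fun _ _ _ _ => ofReal_mul_self_le_inv_sixteen (by norm_num) le_rfl)
    ?_).trans ?_
  · split_ifs
    · exact Measurable.const_mul
        (by fun_prop : Measurable fun x : ℝ × ℝ => band δ (k * x.1 - l * x.2)) _
    · exact measurable_const
  · by_cases hcond : (k ≠ 0 ∧ s ≤ t) ∧ |k * t - l * s| < δ
    swap
    · have : forceKernel δ A k l t s = 0 := by
        unfold forceKernel band
        split_ifs with h1 h2 <;> simp_all
      simp [this]
    obtain ⟨⟨hk, hst⟩, hd⟩ := hcond
    by_cases hN : k.natAbs * (t - δ) ≤ N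
    swap
    · simp only [v, if_neg hN, zero_mul]
      exact zero_le
    obtain ⟨hnat, hd'⟩ := natAbs_eq_of_resonance hδ' hk hl hs hst hd
    rw [hnat] at hd'
    have hd1 := (abs_lt.1 hd').2
    have hd2 := (abs_lt.1 hd').1
    -- the driving mode stays in the region: `|l| (s - δ) ≤ |k| (t - δ)`
    have hN' : l.natAbs * (s - δ) ≤ N := by
      refine le_trans ?_ hN
      rw [hnat]
      push_cast at hd2 ⊢
      linarith
    have hstep := chainWeight_mul_le hδ hb hA hAb (Int.natAbs_ne_zero.2 hk) (by linarith) hst hd1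
    simp only [v]
    rw [if_pos hN, if_pos hN', if_pos hnat, forceKernel, if_pos ⟨hk, hst⟩, band, if_pos hd,
      mul_one, mul_one, ← ENNReal.ofReal_mul' (mul_nonneg (sub_nonneg.2 hst) hA),
      ← ENNReal.ofReal_mul (by positivity), hnat]
    exact ENNReal.ofReal_le_ofReal hstep
  · have hl1 := one_le_abs_intCast hl0
    split_ifs with hnat
    · rw [lintegral_const_mul _ (by fun_prop)]
      refine (mul_le_mul_right (lintegral_band_sub_mul_le (by exact_mod_cast hl0) _) _).trans ?_
      rw [← ENNReal.ofReal_mul (by positivity)]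
      refine ENNReal.ofReal_le_ofReal ?_
      have h1 : |(l : ℝ)| = k.natAbs + 1 := by
        have : (l.natAbs : ℝ) = |(l : ℝ)| := by rw [Nat.cast_natAbs]; push_cast; rfl
        rw [← this, hnat]
        push_cast
        rfl
      rw [h1]
      have h2 : (k.natAbs : ℝ) / 2 * (2 * (δ / (k.natAbs + 1)))
          = δ * (k.natAbs / (k.natAbs + 1)) := by field_simp
      have h3 : (k.natAbs : ℝ) / (k.natAbs + 1) ≤ 1 := by
        rw [div_le_one (by positivity)]
        linarith
      rw [h2]
      nlinarith
    · simp
  · split_ifs with hnat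
    · by_cases hk : k = 0
      · simp [hk]
      rw [lintegral_const_mul _ (by fun_prop)]
      refine (mul_le_mul_right (lintegral_band_mul_sub_le (by exact_mod_cast hk) _) _).trans ?_
      rw [← ENNReal.ofReal_mul (by positivity)]
      refine ENNReal.ofReal_le_ofReal ?_
      have h1 : (k.natAbs : ℝ) = |(k : ℝ)| := by rw [Nat.cast_natAbs]; push_cast; rfl
      have h2 := one_le_abs_intCast hk
      rw [h1]
      have h3 : |(k : ℝ)| / 2 * (2 * (δ / |(k : ℝ)|)) = δ := by field_simp
      rw [h3]
      linarith
    · simp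
  · set B := ENNReal.ofReal (Real.exp ((6 / 10 + 3 * b) * (2 * N : ℝ) ^ (1 / 3 : ℝ))) with hB
    refine lt_of_le_of_lt (weightedSq_mono_weight
      (w' := fun _ t => if t ≤ (N : ℝ) + 1 then B * 1 else 0) measurableSet_Ici hf0
      fun k hk t ht => ?_) ?_
    · have ht' : (100 : ℝ) ≤ t := ht
      have hk1 : (1 : ℝ) ≤ k.natAbs := by
        exact_mod_cast Nat.one_le_iff_ne_zero.2 (Int.natAbs_ne_zero.2 hk)
      by_cases hN : k.natAbs * (t - δ) ≤ N
      · have htN : t ≤ (N : ℝ) + 1 := by nlinarith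
        simp only [v]
        rw [if_pos hN, if_pos htN, mul_one, hB]
        refine ENNReal.ofReal_le_ofReal ((chainWeight_le_exp hδ hb _ (by linarith)).trans ?_)
        have hle' : k.natAbs * (t + δ) ≤ 2 * (N : ℝ) := by
          have : 0 ≤ (k.natAbs : ℝ) * (t - 3 * δ) := mul_nonneg (by linarith) (by linarith)
          linarith
        have := Real.rpow_le_rpow (mul_nonneg (by linarith) (by linarith)) hle'
          (by norm_num : (0 : ℝ) ≤ 1 / 3)
        gcongr
      · simp only [v, if_neg hN]
        exact zero_le
    · rw [weightedSq_ite, weightedSq_const_mul _ ENNReal.ofReal_ne_top]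
      exact ENNReal.mul_lt_top (by simp) (hfin _)
  · gcongr
    refine ENNReal.tsum_le_tsum fun k => lintegral_mono fun t => ?_
    gcongr
    simp only [v]
    split_ifs
    · exact le_rfl
    · exact zero_le

/-- Space-time bound for the force field, with a loss in the Gevrey exponent that depends on the
strength `|ε| M` of the echoes through its cube root. -/
theorem IsLVPSolution.weightedSq_force_le {W : ℤ → ℂ} {ε : ℝ} {ψ : 𝓢(ℝ, ℂ)} {h₀ : ℤ → ℝ → ℂ}
    {h : ℝ → ℤ → ℝ → ℂ} (sol : IsLVPSolution W ε ψ 100 h₀ h)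
    (hW : ∀ k : ℤ, k ≠ 0 → ‖W k‖ = 1 / (k : ℝ) ^ 2) {δ M : ℝ} (hδ : 0 < δ) (hδ' : δ < 1 / 10)
    (hψ : Function.support (psiHat ψ) ⊆ Ioo (-δ) δ) (hM : ∀ ξ, ‖psiHat ψ ξ‖ ≤ M)
    {b c : ℝ} (hb : 0 ≤ b) (hεb : |ε| * M ≤ b ^ 3) (hc : 132 / 100 + 66 / 10 * b ≤ c) :
    weightedSq (Ici 100) (gevreyWeight (12 / 10)) (force W h) ≤ 4 * gevreyEnergy c h₀ := by
  have hM0 : 0 ≤ M := (norm_nonneg _).trans (hM 0)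
  have h1 := weightedSq_chainWeight_le hδ hδ' hb (A := |ε| / 2 * M) (by positivity)
    (by linarith) sol.force_measurable (force_zero_mode W h)
    (fun t ht k => sol.enorm_force_le_add hW hψ hM ht k) sol.weightedSq_one_lt_top
  refine (weightedSq_mono_weight measurableSet_Ici (force_zero_mode W h) fun k hk t ht => ?_).trans
    (h1.trans ?_)
  · have ht' : (0 : ℝ) ≤ t := le_trans (by norm_num) (mem_Ici.1 ht)
    unfold gevreyWeight
    refine ENNReal.ofReal_le_ofReal (le_trans (le_of_eq ?_)
      (exp_le_chainWeight hδ hb (Int.natAbs_ne_zero.2 hk) ht'))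
    rw [natAbs_mul_eq_abs k ht']
    norm_num
  · gcongr
    refine weightedSq_freeTransport_le hW measurableSet_Ici (fun k hk t ht => ?_) h₀
    refine ENNReal.ofReal_le_ofReal ((chainWeight_le_exp_half hδ hδ' hb hc _ ht).trans
      (le_of_eq ?_))
    rw [natAbs_mul_eq_abs k (le_trans (by norm_num) (mem_Ici.1 ht))]

/-! ### Existence -/

/-- The measure on modes and times for which the Volterra operator is, for large `r`, a contraction
of `L²`. -/
def fieldMeasure (r T₀ : ℝ) : Measure (ℤ × ℝ) :=
  Measure.count.prod ((volume.restrict (Ici T₀)).withDensity fun t => decayWeight r T₀ t ^ 2)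

theorem eLpNorm_fieldMeasure_sq {r T₀ : ℝ} {u : ℤ × ℝ → ℂ} (hu : Measurable u) :
    eLpNorm u 2 (fieldMeasure r T₀) ^ 2
      = weightedSq (Ici T₀) (fun _ => decayWeight r T₀) fun t k => u (k, t) := by
  have h := eLpNorm_nnreal_pow_eq_lintegral (f := u) (μ := fieldMeasure r T₀) (p := 2) two_ne_zero
  norm_num at h
  have h' : eLpNorm u 2 (fieldMeasure r T₀) ^ 2 = ∫⁻ p, ‖u p‖ₑ ^ 2 ∂(fieldMeasure r T₀) := by
    exact_mod_cast h
  rw [h', fieldMeasure, lintegral_prod _ (hu.enorm.pow_const 2).aemeasurable, lintegral_count]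
  refine tsum_congr fun k => ?_
  have hk : Measurable fun t => ‖u (k, t)‖ₑ ^ 2 :=
    (hu.comp measurable_prodMk_left).enorm.pow_const 2
  rw [lintegral_withDensity_eq_lintegral_mul _ ((measurable_decayWeight r T₀).pow_const 2) hk]
  refine lintegral_congr fun t => ?_
  simp [mul_pow]

theorem ae_restrict_of_ae_fieldMeasure {r T₀ : ℝ} {p : ℤ × ℝ → Prop}
    (h : ∀ᵐ x ∂(fieldMeasure r T₀), p x) (k : ℤ) :
    ∀ᵐ t ∂(volume.restrict (Ici T₀)), p (k, t) := by
  have h1 := Measure.ae_count_iff.1 (Measure.ae_ae_of_ae_prod h) k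
  refine (withDensity_absolutelyContinuous' (f := fun t => decayWeight r T₀ t ^ 2)
    ((measurable_decayWeight r T₀).pow_const 2).aemeasurable
    (Eventually.of_forall fun t => ?_)).ae_le h1
  simp [decayWeight, Real.exp_pos]

/-- The response operator: the force field generated by the part of the solution that a given
force field `u` produces out of the profile. -/
def volterra (W : ℤ → ℂ) (ε : ℝ) (ψ : 𝓢(ℝ, ℂ)) (T₀ : ℝ) (u : ℤ × ℝ → ℂ) (p : ℤ × ℝ) : ℂ :=
  -(Complex.I * (p.1 : ℂ) * W p.1 * ∑ l ∈ ({p.1 - 1, p.1 + 1} : Finset ℤ),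
    ∫ s in Ioc T₀ p.2, u (l, s) * duhamelKernel ε ψ p.1 l (p.1 * p.2) s)

theorem measurable_volterra (W : ℤ → ℂ) (ε : ℝ) (ψ : 𝓢(ℝ, ℂ)) (T₀ : ℝ) {u : ℤ × ℝ → ℂ}
    (hu : Measurable u) : Measurable (volterra W ε ψ T₀ u) := by
  refine measurable_from_prod_countable_right fun k => ?_
  simp only [volterra]
  refine Measurable.fun_neg (Measurable.const_mul (Finset.measurable_fun_sum _ fun l _ => ?_) _)
  have hk : Continuous fun x : ℝ × ℝ => duhamelKernel ε ψ k l (k * x.1) x.2 := by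
    have := continuous_psiHat ψ
    unfold duhamelKernel
    fun_prop
  have hm : Measurable fun x : ℝ × ℝ => u (l, x.2) * duhamelKernel ε ψ k l (k * x.1) x.2 :=
    (hu.comp (measurable_const.prodMk measurable_snd)).mul hk.measurable
  have hset : MeasurableSet {x : ℝ × ℝ | T₀ < x.2 ∧ x.2 ≤ x.1} :=
    (measurableSet_lt measurable_const measurable_snd).inter
      (measurableSet_le measurable_snd measurable_fst)
  have h := (hm.stronglyMeasurable.indicator hset).integral_prod_right' (ν := volume)
  convert h.measurable using 2 with t
  rw [← integral_indicator measurableSet_Ioc]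
  rfl

section

variable {W : ℤ → ℂ} {δ M : ℝ} {ψ : 𝓢(ℝ, ℂ)} {ε T₀ r : ℝ}

theorem eLpNorm_volterra_le (hW : ∀ k : ℤ, k ≠ 0 → ‖W k‖ = 1 / (k : ℝ) ^ 2)
    (hψ : Function.support (psiHat ψ) ⊆ Ioo (-δ) δ) (hM : ∀ ξ, ‖psiHat ψ ξ‖ ≤ M) (hr : 0 < r)
    (hr' : 4 * (|ε| / 2 * M) ≤ r ^ 2) {u : ℤ × ℝ → ℂ} (hu : Measurable u) :
    eLpNorm (volterra W ε ψ T₀ u) 2 (fieldMeasure r T₀)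
      ≤ 2⁻¹ * eLpNorm u 2 (fieldMeasure r T₀) := by
  have hM0 : 0 ≤ M := (norm_nonneg _).trans (hM 0)
  set A := |ε| / 2 * M with hA
  have hA0 : 0 ≤ A := by positivity
  have h := tsum_lintegral_kernel_sq_le (ν := fun _ => volume.restrict (Ici T₀)) (S := Ici T₀)
    measurableSet_Ici (f := fun t k => u (k, t))
    (fun l => (hu.comp measurable_prodMk_left).aestronglyMeasurable)
    (P := fun _ => True) (fun _ _ hl => absurd trivial hl)
    (w := fun _ => decayWeight r T₀) (fun _ => measurable_decayWeight r T₀)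
    (κ := fun k l t s => decayWeight r T₀ t * forceKernel δ A k l t s)
    (fun _ _ => measurable_const_mul_decayKernel_sub r A)
    (fun k l _ _ => Eventually.of_forall fun t s _ =>
      decayWeight_mul_forceKernel_le r T₀ δ hA0 k l t s)
    (fun _ _ _ _ t => (setLIntegral_le_lintegral _ _).trans
      (lintegral_const_mul_decayKernel_sub_left hr hA0 t).le)
    (fun _ _ _ _ s => (setLIntegral_le_lintegral _ _).trans
      (lintegral_const_mul_decayKernel_sub_right hr hA0 s).le)
    (fun _ _ _ _ => ofReal_mul_self_le_inv_sixteen (by positivity) (by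
      rw [div_le_iff₀ (by positivity)]
      linarith))
  refine (ENNReal.pow_le_pow_left_iff two_ne_zero).1 ?_
  rw [mul_pow, eLpNorm_fieldMeasure_sq hu,
    eLpNorm_fieldMeasure_sq (measurable_volterra W ε ψ T₀ hu)]
  have h4 : (4 : ℝ≥0∞) * 16⁻¹ = 2⁻¹ ^ 2 := by
    rw [show (16 : ℝ≥0∞) = 4 * 4 by norm_num,
      ENNReal.mul_inv (Or.inl (by norm_num)) (Or.inl (by norm_num)), ← mul_assoc,
      ENNReal.mul_inv_cancel (by norm_num) (by norm_num), one_mul, ← ENNReal.inv_pow]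
    norm_num
  rw [← h4]
  refine le_trans (ENNReal.tsum_le_tsum fun k => lintegral_mono fun t => ?_) h
  refine pow_le_pow_left' ?_ 2
  calc _ ≤ decayWeight r T₀ t * ∑ l ∈ ({k - 1, k + 1} : Finset ℤ),
        ∫⁻ s in Ici T₀, forceKernel δ A k l t s * ‖u (l, s)‖ₑ := by
        gcongr
        unfold volterra
        rw [enorm_neg]
        exact enorm_multiplier_mul_sum_integral_le hW hψ hM ε T₀ (fun s l => u (l, s)) t k
          measurableSet_Ici (fun _ _ _ s hs _ _ => hs)
    _ ≤ _ := by
        rw [Finset.mul_sum]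
        refine Finset.sum_le_sum fun l _ => (lintegral_const_mul_le _ _).trans (le_of_eq ?_)
        simp_rw [mul_assoc]

theorem weightedSq_Icc_one_lt_top (hr : 0 ≤ r) {u : ℤ × ℝ → ℂ} (hu : Measurable u)
    (hfin : MemLp u 2 (fieldMeasure r T₀)) (T : ℝ) :
    weightedSq (Icc T₀ T) (fun _ _ => 1) (fun t k => u (k, t)) < ∞ := by
  have h1 := eLpNorm_fieldMeasure_sq (r := r) (T₀ := T₀) hu
  calc _ ≤ weightedSq (Icc T₀ T)
        (fun _ t => ENNReal.ofReal (Real.exp (r * (T - T₀))) * decayWeight r T₀ t)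
        fun t k => u (k, t) := by
        refine ENNReal.tsum_le_tsum fun k => setLIntegral_mono_ae' measurableSet_Icc
          (Eventually.of_forall fun t ht => ?_)
        gcongr
        exact one_le_exp_mul_decayWeight hr ht.2
    _ ≤ ENNReal.ofReal (Real.exp (r * (T - T₀))) ^ 2 *
        eLpNorm u 2 (fieldMeasure r T₀) ^ 2 := by
        rw [weightedSq_const_mul _ ENNReal.ofReal_ne_top, h1]
        gcongr
        exact weightedSq_mono_set Icc_subset_Ici_self _ _
    _ < ∞ := ENNReal.mul_lt_top (by simp) (ENNReal.pow_lt_top hfin.2)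

theorem volterra_sub (hr : 0 ≤ r) {u u' : ℤ × ℝ → ℂ} (hu : Measurable u) (hu' : Measurable u')
    (hfin : MemLp u 2 (fieldMeasure r T₀)) (hfin' : MemLp u' 2 (fieldMeasure r T₀)) :
    volterra W ε ψ T₀ (u - u') = volterra W ε ψ T₀ u - volterra W ε ψ T₀ u' := by
  ext ⟨k, t⟩
  have hint : ∀ {v : ℤ × ℝ → ℂ}, Measurable v → MemLp v 2 (fieldMeasure r T₀) → ∀ l,
      IntegrableOn (fun s => v (l, s) * duhamelKernel ε ψ k l (k * t) s) (Ioc T₀ t) :=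
    fun {v} hv hvfin l => (integrableOn_mul_duhamelKernel (f := fun t k => v (k, t))
      (fun l => (hv.comp measurable_prodMk_left).aestronglyMeasurable)
      (weightedSq_Icc_one_lt_top hr hv hvfin t) ε ψ k l _).mono_set Ioc_subset_Icc_self
  have e : ∀ l, ∫ s in Ioc T₀ t, (u - u') (l, s) * duhamelKernel ε ψ k l (k * t) s
      = (∫ s in Ioc T₀ t, u (l, s) * duhamelKernel ε ψ k l (k * t) s)
        - ∫ s in Ioc T₀ t, u' (l, s) * duhamelKernel ε ψ k l (k * t) s := by
    intro l
    rw [← integral_sub (hint hu hfin l) (hint hu' hfin' l)]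
    simp [sub_mul]
  simp only [volterra, Pi.sub_apply] at e ⊢
  simp_rw [e]
  rw [Finset.sum_sub_distrib]
  ring

theorem exists_eq_add_volterra (hW : ∀ k : ℤ, k ≠ 0 → ‖W k‖ = 1 / (k : ℝ) ^ 2)
    (hψ : Function.support (psiHat ψ) ⊆ Ioo (-δ) δ) (hM : ∀ ξ, ‖psiHat ψ ξ‖ ≤ M) (hr : 0 < r)
    (hr' : 4 * (|ε| / 2 * M) ≤ r ^ 2) {F : ℤ × ℝ → ℂ}
    (hFfin : MemLp F 2 (fieldMeasure r T₀)) : ∃ u : ℤ × ℝ → ℂ, Measurable u ∧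
      MemLp u 2 (fieldMeasure r T₀) ∧ u =ᵐ[fieldMeasure r T₀] F + volterra W ε ψ T₀ u := by
  have hLp : ∀ v : Lp ℂ 2 (fieldMeasure r T₀), MemLp (F + volterra W ε ψ T₀ v) 2
      (fieldMeasure r T₀) := fun v => by
    have hv : Measurable v := (Lp.stronglyMeasurable v).measurable
    refine hFfin.add ⟨(measurable_volterra W ε ψ T₀ hv).aestronglyMeasurable, ?_⟩
    exact (eLpNorm_volterra_le hW hψ hM hr hr' hv).trans_lt
      (ENNReal.mul_lt_top (by simp) (Lp.memLp v).2)
  let Φ : Lp ℂ 2 (fieldMeasure r T₀) → Lp ℂ 2 (fieldMeasure r T₀) := fun v => (hLp v).toLp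
  have hΦ : ContractingWith 2⁻¹ Φ := by
    refine ⟨by rw [← NNReal.coe_lt_coe]; norm_num, fun v v' => ?_⟩
    have hv : Measurable v := (Lp.stronglyMeasurable v).measurable
    have hv' : Measurable v' := (Lp.stronglyMeasurable v').measurable
    rw [Lp.edist_toLp_toLp, Lp.edist_def, add_sub_add_left_eq_sub,
      ← volterra_sub hr.le hv hv' (Lp.memLp v) (Lp.memLp v')]
    refine (eLpNorm_volterra_le hW hψ hM hr hr' (hv.sub hv')).trans (le_of_eq ?_)
    simp
  have hfix : Φ (ContractingWith.fixedPoint Φ hΦ) = ContractingWith.fixedPoint Φ hΦ :=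
    hΦ.fixedPoint_isFixedPt
  set v := ContractingWith.fixedPoint Φ hΦ
  refine ⟨v, (Lp.stronglyMeasurable v).measurable, Lp.memLp v, ?_⟩
  have h1 := (hLp v).coeFn_toLp
  have h2 : (hLp v).toLp = v := hfix
  rw [h2] at h1
  exact h1

/-- Existence for square integrable data: the force field is constructed as the fixed point of a
contraction, and the solution is given by the Duhamel formula. -/
theorem exists_isLVPSolution (hW : ∀ k : ℤ, k ≠ 0 → ‖W k‖ = 1 / (k : ℝ) ^ 2)
    (hψ : Function.support (psiHat ψ) ⊆ Ioo (-δ) δ) (ε T₀ : ℝ) {h₀ : ℤ → ℝ → ℂ}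
    (hm : ∀ k, AEStronglyMeasurable (h₀ k) volume) (hfin : gevreyEnergy 0 h₀ < ∞) :
    ∃ h, IsLVPSolution W ε ψ T₀ h₀ h := by
  obtain ⟨M, hM0, hM⟩ := exists_norm_psiHat_le ψ
  have hA0 : 0 ≤ |ε| / 2 * M := by positivity
  set r := 4 * (|ε| / 2 * M) + 1 with hr
  have hr1 : 1 ≤ r := by linarith
  have hr0 : 0 < r := by linarith
  have hFm := aestronglyMeasurable_force_freeTransport W hm
  let F : ℤ × ℝ → ℂ := fun p => (hFm p.1).mk _ p.2
  have hF : Measurable F :=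
    measurable_from_prod_countable_right fun k => (hFm k).stronglyMeasurable_mk.measurable
  have hFae : ∀ k, ∀ᵐ t, force W (fun _ => h₀) t k = F (k, t) := fun k => (hFm k).ae_eq_mk
  have hFfin : MemLp F 2 (fieldMeasure r T₀) := by
    refine ⟨hF.aestronglyMeasurable, ?_⟩
    have h1 : eLpNorm F 2 (fieldMeasure r T₀) ^ 2 < ∞ := by
      rw [eLpNorm_fieldMeasure_sq hF]
      have h2 : weightedSq (Ici T₀) (fun _ => decayWeight r T₀) (fun t k => F (k, t))
          = weightedSq (Ici T₀) (fun _ => decayWeight r T₀) (force W fun _ => h₀) := by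
        refine tsum_congr fun k => lintegral_congr_ae ?_
        filter_upwards [ae_restrict_of_ae (hFae k)] with t ht
        rw [ht]
      rw [h2]
      refine (weightedSq_freeTransport_le (c := 0) hW measurableSet_Ici
        (fun k _ t ht => ?_) h₀).trans_lt hfin
      simpa using decayWeight_le_one hr0.le ht
    by_contra htop
    rw [not_lt_top_iff.1 htop] at h1
    simp at h1
  obtain ⟨u, hu, hufin, hueq⟩ := exists_eq_add_volterra (T₀ := T₀) (ε := ε) hW hψ hM hr0
    (by nlinarith) hFfin
  let h : ℝ → ℤ → ℝ → ℂ := fun t k η => h₀ k η - ∑ l ∈ ({k - 1, k + 1} : Finset ℤ),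
    ∫ s in T₀..t, u (l, s) * duhamelKernel ε ψ k l η s
  have hforce : ∀ t, T₀ ≤ t → ∀ k,
      force W h t k = force W (fun _ => h₀) t k + volterra W ε ψ T₀ u (k, t) := by
    intro t ht k
    simp only [force, volterra, h]
    simp_rw [intervalIntegral.integral_of_le ht]
    ring
  have hae : ∀ k, ∀ᵐ t ∂(volume.restrict (Ici T₀)), force W h t k = u (k, t) := by
    intro k
    filter_upwards [ae_restrict_of_ae_fieldMeasure hueq k, ae_restrict_of_ae (hFae k),
      ae_restrict_mem measurableSet_Ici] with t h1 h2 h3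
    rw [hforce t h3, h1, Pi.add_apply, h2]
  have hsm : ∀ k, AEStronglyMeasurable (fun t => force W h t k) (volume.restrict (Ici T₀)) :=
    fun k => (hu.comp measurable_prodMk_left).aestronglyMeasurable.congr
      ((hae k).mono fun t ht => ht.symm)
  refine ⟨h, hsm, fun T => ?_, fun t ht k η => ?_⟩
  · rw [lintegral_fieldSq fun k =>
      (hsm k).mono_measure (Measure.restrict_mono Icc_subset_Ici_self le_rfl)]
    refine lt_of_eq_of_lt ?_ (weightedSq_Icc_one_lt_top hr0.le hu hufin T)
    refine tsum_congr fun k => lintegral_congr_ae ?_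
    filter_upwards [ae_restrict_of_ae_restrict_of_subset Icc_subset_Ici_self (hae k)] with t ht
    rw [ht]
  · change h₀ k η - _ = h₀ k η - _
    congr 1
    refine Finset.sum_congr rfl fun l _ => ?_
    rw [intervalIntegral.integral_of_le ht, intervalIntegral.integral_of_le ht]
    refine integral_congr_ae ?_
    filter_upwards [ae_restrict_of_ae_restrict_of_subset
      (Ioc_subset_Icc_self.trans Icc_subset_Ici_self) (hae l)] with s hs
    rw [hs]
    rfl

end

/-! ### Stability -/

theorem tendsto_weightedSq_Ici_zero {T₀ : ℝ} {w : ℤ → ℝ → ℝ≥0∞} (hw : ∀ l, Measurable (w l))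
    {f : ℝ → ℤ → ℂ}
    (hf : ∀ l, AEStronglyMeasurable (fun t => f t l) (volume.restrict (Ici T₀)))
    (hfin : weightedSq (Ici T₀) w f < ∞) :
    Tendsto (fun τ => weightedSq (Ici τ) w f) atTop (𝓝 0) := by
  let G : ℝ → ℝ≥0∞ := fun t => ∑' k, (w k t * ‖f t k‖ₑ) ^ 2
  have hG : ∀ τ, T₀ ≤ τ → weightedSq (Ici τ) w f
      = (volume.restrict (Ici T₀)).withDensity G (Ici τ) := by
    intro τ hτ
    rw [withDensity_apply _ measurableSet_Ici, Measure.restrict_restrict measurableSet_Ici,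
      inter_eq_left.2 (Ici_subset_Ici.2 hτ), weightedSq, lintegral_tsum fun k => ?_]
    exact ((hw k).aemeasurable.mul
      ((hf k).mono_measure (Measure.restrict_mono (Ici_subset_Ici.2 hτ) le_rfl)).enorm).pow_const 2
  have h := tendsto_measure_iInter_atTop (μ := (volume.restrict (Ici T₀)).withDensity G)
    (s := fun τ : ℝ => Ici τ) (fun τ => measurableSet_Ici.nullMeasurableSet)
    (fun a b hab => Ici_subset_Ici.2 hab) ⟨T₀, by rw [← hG T₀ le_rfl]; exact hfin.ne⟩
  have hempty : ⋂ τ : ℝ, Ici τ = ∅ := by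
    ext x
    simp only [mem_iInter, mem_Ici, mem_empty_iff_false, iff_false, not_forall, not_le]
    exact exists_gt x
  rw [hempty, measure_empty] at h
  refine h.congr' ?_
  filter_upwards [eventually_ge_atTop T₀] with τ hτ
  exact (hG τ hτ).symm

/-- The constant comes from the term `(y / 10) ^ 3 / 3!` of the exponential series. -/
theorem one_add_pow_three_le_exp {y : ℝ} (hy : 0 ≤ y) :
    1 + y ^ 3 ≤ 6001 * Real.exp (1 / 10 * y) := by
  have h1 := Real.pow_div_factorial_le_exp (1 / 10 * y) (by positivity) 3
  have h2 : 1 ≤ Real.exp (1 / 10 * y) := Real.one_le_exp (by positivity)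
  norm_num [Nat.factorial] at h1
  nlinarith

/-- The difference between the exponents `1.2` and `1` absorbs a power of the frequency. -/
theorem one_add_mul_exp_le {l : ℤ} (hl : l ≠ 0) {s : ℝ} (hs : 0 ≤ s) :
    (1 + s) * Real.exp (1 / 2 * |(l : ℝ) * s| ^ (1 / 3 : ℝ))
      ≤ 6001 * Real.exp (12 / 10 / 2 * |(l : ℝ) * s| ^ (1 / 3 : ℝ)) := by
  have hls : s ≤ |(l : ℝ) * s| := by
    rw [abs_mul, abs_of_nonneg hs]
    exact le_mul_of_one_le_left hs (one_le_abs_intCast hl)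
  set y := |(l : ℝ) * s| ^ (1 / 3 : ℝ) with hy
  have hy0 : 0 ≤ y := by positivity
  have hy3 : y ^ 3 = |(l : ℝ) * s| := cbrt_pow_three (abs_nonneg _)
  calc (1 + s) * Real.exp (1 / 2 * y) ≤ 6001 * Real.exp (1 / 10 * y) * Real.exp (1 / 2 * y) := by
        gcongr
        exact (by linarith : 1 + s ≤ 1 + y ^ 3).trans (one_add_pow_three_le_exp hy0)
    _ = _ := by
      rw [mul_assoc, ← Real.exp_add]
      ring_nf

section

variable {W : ℤ → ℂ} {δ M : ℝ} {ψ : 𝓢(ℝ, ℂ)} {ε : ℝ}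

/-- The constant of the bounds for the response to the force field. -/
def responseConst (ε M : ℝ) : ℝ≥0 := (Real.exp (1 / 2) * (6001 * (3 * (|ε| / 2 * M)))).toNNReal

theorem coe_responseConst (ε M : ℝ) : (responseConst ε M : ℝ≥0∞)
    = ENNReal.ofReal (Real.exp (1 / 2) * (6001 * (3 * (|ε| / 2 * M)))) := rfl

/-- In the resonance band the factor `η - k s` is at most `1 + s`, which the larger Gevrey exponent
of the force field absorbs. -/
theorem duhamel_weight_le (hδ : 0 < δ) (hδ' : δ < 1 / 10) (hM : 0 ≤ M) {k l : ℤ}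
    (hl : l ∈ ({k - 1, k + 1} : Finset ℤ)) (hl0 : l ≠ 0) {η s : ℝ} (hs : 0 ≤ s)
    (hd : |η - l * s| < δ) :
    ENNReal.ofReal (Real.exp (1 / 2 * |η| ^ (1 / 3 : ℝ)) * (|η - k * s| * (|ε| / 2 * M)))
      ≤ responseConst ε M * gevreyWeight (12 / 10) l s := by
  rw [coe_responseConst, gevreyWeight, ← ENNReal.ofReal_mul (by positivity)]
  refine ENNReal.ofReal_le_ofReal ?_
  have h1 := exp_cbrt_le (c := 1) zero_le_one hδ hδ' hd
  have h2 : |η - k * s| ≤ 1 + s := (abs_sub_mul_le_of_neighbor hl hs hd).trans (by linarith)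
  have h3 := one_add_mul_exp_le hl0 hs
  have hA : |ε| / 2 * M ≤ 3 * (|ε| / 2 * M) := by
    have : 0 ≤ |ε| / 2 * M := by positivity
    linarith
  calc _ ≤ Real.exp (1 / 2) * Real.exp (1 / 2 * |(l : ℝ) * s| ^ (1 / 3 : ℝ))
        * ((1 + s) * (3 * (|ε| / 2 * M))) := by gcongr
    _ = Real.exp (1 / 2) * ((1 + s) * Real.exp (1 / 2 * |(l : ℝ) * s| ^ (1 / 3 : ℝ)))
        * (3 * (|ε| / 2 * M)) := by ring
    _ ≤ Real.exp (1 / 2) * (6001 * Real.exp (12 / 10 / 2 * |(l : ℝ) * s| ^ (1 / 3 : ℝ)))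
        * (3 * (|ε| / 2 * M)) := by gcongr
    _ = _ := by ring

theorem forceKernel_le_band_mul (hM : 0 ≤ M) (k : ℤ) {l : ℤ} (hl0 : l ≠ 0) {t s : ℝ}
    (hs : 0 ≤ s) (hts : t / 3 ≤ s) :
    forceKernel δ (|ε| / 2 * M) k l t s
      ≤ responseConst ε M * band δ (k * t - l * s) * gevreyWeight (12 / 10) l s := by
  unfold forceKernel
  split_ifs with hcond
  swap
  · exact zero_le
  rw [mul_right_comm]
  refine mul_le_mul_left ?_ _
  rw [coe_responseConst, gevreyWeight, ← ENNReal.ofReal_mul (by positivity)]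
  refine ENNReal.ofReal_le_ofReal ?_
  have h3 := one_add_mul_exp_le hl0 hs
  have h4 : 1 ≤ Real.exp (1 / 2 * |(l : ℝ) * s| ^ (1 / 3 : ℝ)) := Real.one_le_exp (by positivity)
  have h5 : 1 ≤ Real.exp (1 / 2) := Real.one_le_exp (by norm_num)
  calc (t - s) * (|ε| / 2 * M) ≤ 3 * (1 + s) * (|ε| / 2 * M) := by
        gcongr
        linarith
    _ = 1 * ((1 + s) * 1) * (3 * (|ε| / 2 * M)) := by ring
    _ ≤ Real.exp (1 / 2) * ((1 + s) * Real.exp (1 / 2 * |(l : ℝ) * s| ^ (1 / 3 : ℝ)))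
        * (3 * (|ε| / 2 * M)) := by gcongr
    _ ≤ Real.exp (1 / 2) * (6001 * Real.exp (12 / 10 / 2 * |(l : ℝ) * s| ^ (1 / 3 : ℝ)))
        * (3 * (|ε| / 2 * M)) := by gcongr
    _ = _ := by ring

/-- The force field differs from that of free transport by a term that sees only times after
`t / 3`. -/
theorem IsLVPSolution.fieldSq_sub_le {h₀ : ℤ → ℝ → ℂ} {h : ℝ → ℤ → ℝ → ℂ}
    (sol : IsLVPSolution W ε ψ 100 h₀ h) (hW : ∀ k : ℤ, k ≠ 0 → ‖W k‖ = 1 / (k : ℝ) ^ 2)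
    (hδ : 0 < δ) (hδ' : δ < 1 / 10) (hψ : Function.support (psiHat ψ) ⊆ Ioo (-δ) δ)
    (hM : ∀ ξ, ‖psiHat ψ ξ‖ ≤ M) {t : ℝ} (ht : 300 ≤ t) :
    fieldSq (force W h t - force W (fun _ => h₀) t)
      ≤ 4 * responseConst ε M ^ 2 * weightedSq (Ici (t / 3)) (gevreyWeight (12 / 10))
        (force W h) := by
  have hM0 : 0 ≤ M := (norm_nonneg _).trans (hM 0)
  set C : ℝ≥0∞ := ((responseConst ε M : ℝ≥0) : ℝ≥0∞)
  -- the Dirac mass at `t` turns the `L²` bound in time into a pointwise one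
  have h1 := tsum_lintegral_kernel_sq_le (ν := fun _ => Measure.dirac t) (S := Ici (t / 3))
    measurableSet_Ici
    (sol.aestronglyMeasurable (Ici_subset_Ici.2 (by linarith)))
    (P := (· ≠ 0)) (fun t l hl => by rw [not_not.1 hl, force_zero_mode])
    (measurable_gevreyWeight (12 / 10))
    (κ := fun k l t s => forceKernel δ (|ε| / 2 * M) k l t s)
    (a := fun k l t s => C * band δ (k * t - l * s)) (p := fun _ _ => C) (q := fun _ _ => C)
    (D := C ^ 2) (fun k l => ?_) (fun k l hl hl0 => ?_) (fun k l hl hl0 t => ?_)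
    (fun k l hl hl0 s => ?_) (fun k l _ _ => (sq C).ge)
  · refine le_trans (ENNReal.tsum_le_tsum fun k => ?_) h1
    rw [lintegral_dirac]
    refine pow_le_pow_left' ?_ 2
    refine sol.enorm_force_sub_le hW hψ hM (by linarith) k measurableSet_Ici ?_
    intro hk l hl s hs hst hd
    obtain ⟨hnat, hd'⟩ := natAbs_eq_of_resonance hδ' hk hl hs hst hd
    have hk1 : (1 : ℝ) ≤ k.natAbs := by
      exact_mod_cast Nat.one_le_iff_ne_zero.2 (Int.natAbs_ne_zero.2 hk)
    have hd2 := (abs_lt.1 hd').2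
    rw [hnat] at hd2
    push_cast at hd2
    rw [mem_Ici]
    nlinarith
  · exact Measurable.const_mul
      (by fun_prop : Measurable fun x : ℝ × ℝ => band δ (k * x.1 - l * x.2)) C
  · rw [ae_dirac_eq, eventually_pure]
    intro s hs
    have hs' : t / 3 ≤ s := hs
    exact forceKernel_le_band_mul hM0 k hl0 (by linarith) hs'
  · refine (setLIntegral_le_lintegral _ _).trans ?_
    rw [lintegral_const_mul _ (by fun_prop)]
    refine mul_le_of_le_one_right' ((lintegral_band_sub_mul_le (by exact_mod_cast hl0) _).trans ?_)
    exact ofReal_two_mul_div_abs_le_one hδ hδ' hl0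
  · rw [lintegral_dirac]
    exact mul_le_of_le_one_right' (band_le_one _ _)

/-- The limit of the solution: the Duhamel formula over the whole half line of times. -/
def limitProfile (W : ℤ → ℂ) (ε : ℝ) (ψ : 𝓢(ℝ, ℂ)) (T₀ : ℝ) (h₀ : ℤ → ℝ → ℂ)
    (h : ℝ → ℤ → ℝ → ℂ) (k : ℤ) (η : ℝ) : ℂ :=
  h₀ k η - ∑ l ∈ ({k - 1, k + 1} : Finset ℤ),
    ∫ s in Ioi T₀, force W h s l * duhamelKernel ε ψ k l η s

theorem aestronglyMeasurable_setIntegral_duhamel {f : ℝ → ℤ → ℂ} {S : Set ℝ}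
    (hf : ∀ l, AEStronglyMeasurable (fun t => f t l) (volume.restrict S)) (ε : ℝ) (ψ : 𝓢(ℝ, ℂ))
    (k l : ℤ) : AEStronglyMeasurable
      (fun η => ∫ s in S, f s l * duhamelKernel ε ψ k l η s) volume := by
  have h1 : AEStronglyMeasurable (fun x : ℝ × ℝ => f x.2 l) (volume.prod (volume.restrict S)) :=
    (hf l).comp_snd
  exact AEStronglyMeasurable.integral_prod_right'
    (h1.mul (continuous_uncurry_duhamelKernel ε ψ k l).aestronglyMeasurable)

/-- A mode `l ≠ 0` is in resonance with a given frequency during a bounded time only. -/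
theorem IsLVPSolution.integrableOn_Ioi {T₀ : ℝ} {h₀ : ℤ → ℝ → ℂ} {h : ℝ → ℤ → ℝ → ℂ}
    (sol : IsLVPSolution W ε ψ T₀ h₀ h) (hT₀ : 0 ≤ T₀) (hδ' : δ < 1 / 10)
    (hψ : Function.support (psiHat ψ) ⊆ Ioo (-δ) δ) (k l : ℤ) (η : ℝ) :
    IntegrableOn (fun s => force W h s l * duhamelKernel ε ψ k l η s) (Ioi T₀) := by
  by_cases hl : l = 0
  · simp [hl]
  have h1 := integrableOn_mul_duhamelKernel sol.force_measurable
    (sol.weightedSq_one_lt_top (|η| + 1)) ε ψ k l η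
  have h2 : IntegrableOn (fun s => force W h s l * duhamelKernel ε ψ k l η s)
      (Ioi (max T₀ (|η| + 1))) := by
    refine integrableOn_zero.congr_fun (fun s hs => ?_) measurableSet_Ioi
    have hs' := max_lt_iff.1 (mem_Ioi.1 hs)
    have hs0 : 0 ≤ s := hT₀.trans hs'.1.le
    have h3 : psiHat ψ (η - l * s) = 0 := by
      by_contra hne
      have h4 : |η - l * s| < δ := abs_lt.2 (hψ hne)
      have h5 : s ≤ |(l : ℝ) * s| := by
        rw [abs_mul, abs_of_nonneg hs0]
        exact le_mul_of_one_le_left hs0 (one_le_abs_intCast hl)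
      have h6 := abs_sub_abs_le_abs_sub ((l : ℝ) * s) η
      rw [abs_sub_comm] at h6
      linarith [hs'.2]
    simp [duhamelKernel, h3]
  refine (h1.union h2).mono_set fun s hs => ?_
  by_cases h3 : s ≤ |η| + 1
  · exact Or.inl ⟨(mem_Ioi.1 hs).le, h3⟩
  · exact Or.inr (mem_Ioi.2 (max_lt hs (not_le.1 h3)))

theorem IsLVPSolution.sub_limitProfile {T₀ : ℝ} {h₀ : ℤ → ℝ → ℂ} {h : ℝ → ℤ → ℝ → ℂ}
    (sol : IsLVPSolution W ε ψ T₀ h₀ h) (hT₀ : 0 ≤ T₀) (hδ' : δ < 1 / 10)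
    (hψ : Function.support (psiHat ψ) ⊆ Ioo (-δ) δ) {t : ℝ} (ht : T₀ ≤ t) (k : ℤ) (η : ℝ) :
    (h t - limitProfile W ε ψ T₀ h₀ h) k η = ∑ l ∈ ({k - 1, k + 1} : Finset ℤ),
      ∫ s in Ioi t, force W h s l * duhamelKernel ε ψ k l η s := by
  have h1 : ∀ l, ∫ s in Ioi T₀, force W h s l * duhamelKernel ε ψ k l η s
      = (∫ s in T₀..t, force W h s l * duhamelKernel ε ψ k l η s)
        + ∫ s in Ioi t, force W h s l * duhamelKernel ε ψ k l η s := by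
    intro l
    have hint := sol.integrableOn_Ioi hT₀ hδ' hψ k l η
    rw [intervalIntegral.integral_of_le ht, ← Ioc_union_Ioi_eq_Ioi ht,
      setIntegral_union (Ioc_disjoint_Ioi le_rfl) measurableSet_Ioi
        (hint.mono_set Ioc_subset_Ioi_self) (hint.mono_set (Ioi_subset_Ioi ht))]
  simp only [Pi.sub_apply, limitProfile]
  simp_rw [h1]
  rw [Finset.sum_add_distrib]
  linear_combination sol.sub_eq ht k η

theorem tendsto_fieldSq_of_tendsto_sub {F G : ℝ → ℤ → ℂ}
    (h : Tendsto (fun t => fieldSq (F t - G t)) atTop (𝓝 0))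
    (hG : Tendsto (fun t => fieldSq (G t)) atTop (𝓝 0)) :
    Tendsto (fun t => fieldSq (F t)) atTop (𝓝 0) := by
  have h1 : Tendsto (fun t => 2 * fieldSq (F t - G t) + 2 * fieldSq (G t)) atTop (𝓝 0) := by
    have h2 := (ENNReal.Tendsto.const_mul h (Or.inr (by norm_num : (2 : ℝ≥0∞) ≠ ∞))).add
      (ENNReal.Tendsto.const_mul hG (Or.inr (by norm_num : (2 : ℝ≥0∞) ≠ ∞)))
    simpa using h2
  refine tendsto_of_tendsto_of_tendsto_of_le_of_le tendsto_const_nhds h1 (fun _ => zero_le)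
    fun t => ?_
  have h2 := fieldSq_add_le (F t - G t) (G t)
  rwa [sub_add_cancel] at h2

/-- Stability from time `100` on, as soon as the exponent of the datum pays for the echoes. -/
theorem gevreyStable_hundred (hW : ∀ k : ℤ, k ≠ 0 → ‖W k‖ = 1 / (k : ℝ) ^ 2)
    (hδ : 0 < δ) (hδ' : δ < 1 / 10) (hψ : Function.support (psiHat ψ) ⊆ Ioo (-δ) δ)
    (hM : ∀ ξ, ‖psiHat ψ ξ‖ ≤ M) {b c : ℝ} (hb : 0 ≤ b) (hεb : |ε| * M ≤ b ^ 3)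
    (hc : 132 / 100 + 66 / 10 * b ≤ c) : GevreyStable W ε ψ 100 c := by
  have hM0 : 0 ≤ M := (norm_nonneg _).trans (hM 0)
  set R := responseConst ε M with hR
  refine ⟨4 + (2 + 2 * (4 * R ^ 2 * 4)), fun h₀ h hm hfin sol => ?_⟩
  have hX := sol.weightedSq_force_le hW hδ hδ' hψ hM hb hεb hc
  have hXfin : weightedSq (Ici 100) (gevreyWeight (12 / 10)) (force W h) < ∞ :=
    hX.trans_lt (ENNReal.mul_lt_top (by norm_num) hfin)
  have htail := tendsto_weightedSq_Ici_zero (measurable_gevreyWeight (12 / 10))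
    sol.force_measurable hXfin
  have hconst : ∀ x : ℝ≥0∞, x ≤ 4 * gevreyEnergy c h₀ →
      2 * gevreyEnergy c h₀ + 2 * (4 * (R : ℝ≥0∞) ^ 2 * x)
        ≤ (4 + (2 + 2 * (4 * R ^ 2 * 4)) : ℝ≥0) * gevreyEnergy c h₀ := by
    intro x hx
    calc _ ≤ 2 * gevreyEnergy c h₀ + 2 * (4 * (R : ℝ≥0∞) ^ 2 * (4 * gevreyEnergy c h₀)) := by
          gcongr
      _ = ((2 + 2 * (4 * R ^ 2 * 4) : ℝ≥0) : ℝ≥0∞) * gevreyEnergy c h₀ := by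
          push_cast
          ring
      _ ≤ _ := mul_le_mul_left (ENNReal.coe_le_coe.2 le_add_self) _
  -- the energy of a perturbation of the datum by a response to the force field
  have hbound : ∀ S ⊆ Ici (100 : ℝ), MeasurableSet S → ∀ g : ℤ → ℝ → ℂ,
      (∀ k η, ‖(g - h₀) k η‖ = ‖∑ l ∈ ({k - 1, k + 1} : Finset ℤ),
        ∫ s in S, force W h s l * duhamelKernel ε ψ k l η s‖) →
      gevreyEnergy 1 g ≤ (4 + (2 + 2 * (4 * R ^ 2 * 4)) : ℝ≥0) * gevreyEnergy c h₀ := by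
    intro S hS hSm g hg
    have h1 := gevreyEnergy_duhamel_le (c := 1) (C := R) hδ hδ' hψ hM ε hSm
      (sol.aestronglyMeasurable hS) (force_zero_mode W h) (measurable_gevreyWeight (12 / 10))
      fun k l hl hl0 η s hs hd =>
        duhamel_weight_le hδ hδ' hM0 hl hl0 (le_trans (by norm_num) (mem_Ici.1 (hS hs))) hd
    rw [← gevreyEnergy_congr_norm hg] at h1
    have h2 := gevreyEnergy_add_le (c := 1) (g' := g - h₀) hm
    rw [add_sub_cancel] at h2
    refine (h2.trans ?_).trans (hconst _ ((weightedSq_mono_set hS _ _).trans hX))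
    gcongr
    exact gevreyEnergy_mono (by linarith) _
  have hlim : Tendsto (fun τ => 4 * (R : ℝ≥0∞) ^ 2
      * weightedSq (Ici τ) (gevreyWeight (12 / 10)) (force W h)) atTop (𝓝 0) := by
    have := ENNReal.Tendsto.const_mul htail (Or.inr (by finiteness : 4 * (R : ℝ≥0∞) ^ 2 ≠ ∞))
    rwa [mul_zero] at this
  refine ⟨fun t ht => ?_, ⟨limitProfile W ε ψ 100 h₀ h, fun k => ?_, ?_, ?_⟩, ?_, ?_⟩
  · refine hbound (Ioc 100 t) (Ioc_subset_Icc_self.trans Icc_subset_Ici_self) measurableSet_Ioc _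
      fun k η => ?_
    rw [Pi.sub_apply, Pi.sub_apply, sol.sub_eq ht, norm_neg]
    simp_rw [intervalIntegral.integral_of_le ht]
  · exact (hm k).sub (Finset.aestronglyMeasurable_fun_sum _ fun l _ =>
      aestronglyMeasurable_setIntegral_duhamel (sol.aestronglyMeasurable Ioi_subset_Ici_self)
        ε ψ k l)
  · refine hbound (Ioi 100) Ioi_subset_Ici_self measurableSet_Ioi _ fun k η => ?_
    simp [limitProfile]
  · refine tendsto_of_tendsto_of_tendsto_of_le_of_le' tendsto_const_nhds hlim
      (Eventually.of_forall fun _ => zero_le) ?_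
    filter_upwards [eventually_ge_atTop 100] with t ht
    rw [gevreyEnergy_congr_norm fun k η =>
      congrArg norm (sol.sub_limitProfile (by norm_num) hδ' hψ ht k η)]
    refine (gevreyEnergy_duhamel_le (c := 1) (C := R) hδ hδ' hψ hM ε measurableSet_Ioi
      (sol.aestronglyMeasurable ((Ioi_subset_Ioi ht).trans Ioi_subset_Ici_self))
      (force_zero_mode W h) (measurable_gevreyWeight (12 / 10)) fun k l hl hl0 η s hs hd =>
        duhamel_weight_le hδ hδ' hM0 hl hl0
          (le_trans (by linarith) (mem_Ioi.1 hs).le) hd).trans ?_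
    gcongr
    exact weightedSq_mono_set Ioi_subset_Ici_self _ _
  · rw [lintegral_fieldSq sol.force_measurable]
    calc _ ≤ weightedSq (Ici 100) (gevreyWeight (12 / 10)) (force W h) :=
          weightedSq_mono_weight measurableSet_Ici (force_zero_mode W h)
            fun k _ t _ => one_le_gevreyWeight (by norm_num) k t
      _ ≤ ((4 : ℝ≥0) : ℝ≥0∞) * gevreyEnergy c h₀ := by exact_mod_cast hX
      _ ≤ _ := mul_le_mul_left (ENNReal.coe_le_coe.2 le_self_add) _
  · have hsub : Tendsto (fun t => fieldSq (force W h t - force W (fun _ => h₀) t)) atTop (𝓝 0) := by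
      have h3 : Tendsto (fun t : ℝ => t / 3) atTop atTop :=
        tendsto_id.atTop_div_const (by norm_num)
      refine tendsto_of_tendsto_of_tendsto_of_le_of_le' tendsto_const_nhds
        (hlim.comp h3) (Eventually.of_forall fun _ => zero_le) ?_
      filter_upwards [eventually_ge_atTop 300] with t ht
      exact sol.fieldSq_sub_le hW hδ hδ' hψ hM ht
    exact ⟨hsub, tendsto_fieldSq_of_tendsto_sub hsub⟩

/-- A solution may be restarted at a later time. -/
theorem IsLVPSolution.restart {T₀ T₁ : ℝ} {h₀ : ℤ → ℝ → ℂ} {h : ℝ → ℤ → ℝ → ℂ}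
    (sol : IsLVPSolution W ε ψ T₀ h₀ h) (hT : T₀ ≤ T₁) : IsLVPSolution W ε ψ T₁ (h T₁) h where
  force_measurable := sol.aestronglyMeasurable (Ici_subset_Ici.2 hT)
  force_sq_integrable T :=
    (lintegral_mono_set (Icc_subset_Icc_left hT)).trans_lt (sol.force_sq_integrable T)
  duhamel t ht k η := by
    have h1 : ∀ l, ∫ s in T₁..t, force W h s l * duhamelKernel ε ψ k l η s
        = (∫ s in T₀..t, force W h s l * duhamelKernel ε ψ k l η s)
          - ∫ s in T₀..T₁, force W h s l * duhamelKernel ε ψ k l η s := fun l =>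
      (intervalIntegral.integral_interval_sub_left
        (sol.intervalIntegrable le_rfl (hT.trans ht) k l η)
        (sol.intervalIntegrable le_rfl hT k l η)).symm
    change h t k η = h T₁ k η - ∑ l ∈ ({k - 1, k + 1} : Finset ℤ),
      ∫ s in T₁..t, force W h s l * duhamelKernel ε ψ k l η s
    simp_rw [h1]
    rw [Finset.sum_sub_distrib]
    linear_combination sol.sub_eq (hT.trans ht) k η - sol.sub_eq hT k η

theorem IsLVPSolution.aestronglyMeasurable_apply {T₀ : ℝ} {h₀ : ℤ → ℝ → ℂ} {h : ℝ → ℤ → ℝ → ℂ}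
    (sol : IsLVPSolution W ε ψ T₀ h₀ h) (hm : ∀ k, AEStronglyMeasurable (h₀ k) volume) {t : ℝ}
    (ht : T₀ ≤ t) (k : ℤ) : AEStronglyMeasurable (h t k) volume := by
  have h1 : h t k = fun η => h₀ k η - ∑ l ∈ ({k - 1, k + 1} : Finset ℤ),
      ∫ s in Ioc T₀ t, force W h s l * duhamelKernel ε ψ k l η s := by
    ext η
    simp_rw [← intervalIntegral.integral_of_le ht]
    exact sol.duhamel t ht k η
  rw [h1]
  exact (hm k).sub (Finset.aestronglyMeasurable_fun_sum _ fun l _ =>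
    aestronglyMeasurable_setIntegral_duhamel
      (sol.aestronglyMeasurable (Ioc_subset_Icc_self.trans Icc_subset_Ici_self)) ε ψ k l)

/-- The force exerted before time `100` has no effect on the lines `η = k t` with `t ≥ 300`: it
resonates there only if `k t ≈ (k ± 1) s` with `s ≤ 100`. -/
theorem IsLVPSolution.force_freeTransport_eq {h₀ : ℤ → ℝ → ℂ} {h : ℝ → ℤ → ℝ → ℂ}
    (sol : IsLVPSolution W ε ψ 0 h₀ h) (hδ' : δ < 1 / 10)
    (hψ : Function.support (psiHat ψ) ⊆ Ioo (-δ) δ) {t : ℝ} (ht : 300 ≤ t) :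
    force W (fun _ => h 100) t = force W (fun _ => h₀) t := by
  ext k
  by_cases hk : k = 0
  · simp [hk]
  have h1 := sol.sub_eq (t := 100) (by norm_num) k (k * t)
  have h2 : ∑ l ∈ ({k - 1, k + 1} : Finset ℤ),
      ∫ s in (0 : ℝ)..100, force W h s l * duhamelKernel ε ψ k l (k * t) s = 0 := by
    refine Finset.sum_eq_zero fun l hl => ?_
    refine intervalIntegral.integral_zero_ae (Eventually.of_forall fun s hs => ?_)
    rw [uIoc_of_le (by norm_num)] at hs
    have h3 : psiHat ψ (k * t - l * s) = 0 := by
      by_contra hne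
      have h4 : |k * t - l * s| < δ := abs_lt.2 (hψ hne)
      have h5 := abs_sub_mul_le_of_neighbor hl hs.1.le h4
      rw [← mul_sub, abs_mul, abs_of_nonneg (a := t - s) (by linarith [hs.2])] at h5
      nlinarith [one_le_abs_intCast hk, hs.2]
    simp [duhamelKernel, h3]
  rw [h2, neg_zero, sub_eq_zero] at h1
  simp only [force, h1]

/-- Stability from time `0` on, by restarting at time `100`. -/
theorem gevreyStable_zero (hW : ∀ k : ℤ, k ≠ 0 → ‖W k‖ = 1 / (k : ℝ) ^ 2)
    (hδ : 0 < δ) (hδ' : δ < 1 / 10) (hψ : Function.support (psiHat ψ) ⊆ Ioo (-δ) δ) {c : ℝ}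
    (hc : 1 ≤ c) (hst : GevreyStable W ε ψ 100 c) : GevreyStable W ε ψ 0 c := by
  obtain ⟨C, hC⟩ := hst
  obtain ⟨C', hC'⟩ := exists_gevreyEnergy_Icc_le hW hδ hδ' hψ ε (by linarith : 0 ≤ c) le_rfl 100
  refine ⟨C' + C * C', fun h₀ h hm hfin sol => ?_⟩
  have hC'le : (C' : ℝ≥0∞) * gevreyEnergy c h₀ ≤ (C' + C * C' : ℝ≥0) * gevreyEnergy c h₀ :=
    mul_le_mul_left (ENNReal.coe_le_coe.2 le_self_add) _
  obtain ⟨hfield, hE⟩ := hC' h₀ h hm sol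
  have hE100 := hE 100 (by norm_num)
  have hle : (C : ℝ≥0∞) * gevreyEnergy c (h 100) ≤ C * C' * gevreyEnergy c h₀ := by
    rw [mul_assoc]
    gcongr
  have hCC : (C : ℝ≥0∞) * gevreyEnergy c (h 100) ≤ (C' + C * C' : ℝ≥0) * gevreyEnergy c h₀ :=
    hle.trans (by
      rw [← ENNReal.coe_mul]
      exact mul_le_mul_left (ENNReal.coe_le_coe.2 le_add_self) _)
  obtain ⟨h1, ⟨g, hg1, hg2, hg3⟩, h3, h4, -⟩ := hC (h 100) h
    (fun k => sol.aestronglyMeasurable_apply hm (by norm_num) k)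
    (hE100.trans_lt (ENNReal.mul_lt_top (by simp) hfin)) (sol.restart (by norm_num))
  refine ⟨fun t ht => ?_, ⟨g, hg1, hg2.trans hCC, hg3⟩, ?_, ?_⟩
  · rcases le_total t 100 with h | h
    · exact ((gevreyEnergy_mono hc _).trans (hE t ⟨ht, h⟩)).trans hC'le
    · exact (h1 t h).trans hCC
  · have h5 : ∫⁻ t in Icc 0 100, fieldSq (force W h t) ≤ C' * gevreyEnergy c h₀ := by
      rw [lintegral_fieldSq (sol.aestronglyMeasurable Icc_subset_Ici_self)]
      exact (weightedSq_mono_weight measurableSet_Icc (force_zero_mode W h)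
        fun k _ t _ => one_le_gevreyWeight (by linarith) k t).trans hfield
    calc ∫⁻ t in Ici 0, fieldSq (force W h t)
        ≤ ∫⁻ t in Icc 0 100 ∪ Ici 100, fieldSq (force W h t) := by
          refine lintegral_mono_set fun t ht => ?_
          rcases le_total t 100 with h | h
          · exact Or.inl ⟨ht, h⟩
          · exact Or.inr h
      _ ≤ (∫⁻ t in Icc 0 100, fieldSq (force W h t)) + ∫⁻ t in Ici 100, fieldSq (force W h t) :=
          lintegral_union_le _ _ _
      _ ≤ C' * gevreyEnergy c h₀ + C * C' * gevreyEnergy c h₀ := add_le_add h5 (h3.trans hle)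
      _ = _ := by
        push_cast
        ring
  · have h6 : Tendsto (fun t => fieldSq (force W h t - force W (fun _ => h₀) t)) atTop (𝓝 0) := by
      refine h4.congr' ?_
      filter_upwards [eventually_ge_atTop 300] with t ht
      rw [sol.force_freeTransport_eq hδ' hψ ht]
    exact ⟨h6, tendsto_fieldSq_of_tendsto_sub h6⟩

end

end

theorem mainTheorem3 (W : ℤ → ℂ) (hW : ∀ k : ℤ, k ≠ 0 → ‖W k‖ = 1 / (k : ℝ) ^ 2)
    (δ : ℝ) (hδ : 0 < δ) (hδ' : δ < 1 / 10)
    (ψ : 𝓢(ℝ, ℂ)) (hψ : Function.support (psiHat ψ) ⊆ Ioo (-δ) δ) :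
    -- the problem is globally well-posed for square integrable data
    (∀ ε T₀ : ℝ, 0 ≤ T₀ → ∀ h₀ : ℤ → ℝ → ℂ, (∀ k, AEStronglyMeasurable (h₀ k) volume) →
      gevreyEnergy 0 h₀ < ∞ →
      ∃ h : ℝ → ℤ → ℝ → ℂ, IsLVPSolution W ε ψ T₀ h₀ h ∧
        ∀ h' : ℝ → ℤ → ℝ → ℂ, IsLVPSolution W ε ψ T₀ h₀ h' → ∀ t, T₀ ≤ t → h' t = h t) ∧
    -- control of the times in `[0, 100]`, without loss in the exponent
    (∀ ε c : ℝ, 0 < c → ∃ C : ℝ≥0, ∀ (h₀ : ℤ → ℝ → ℂ) (h : ℝ → ℤ → ℝ → ℂ),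
      (∀ k, AEStronglyMeasurable (h₀ k) volume) → gevreyEnergy c h₀ < ∞ →
      IsLVPSolution W ε ψ 0 h₀ h →
      ∀ t ∈ Icc (0 : ℝ) 100, gevreyEnergy c (h t) ≤ C * gevreyEnergy c h₀) ∧
    -- stability for data at time `100` and at time `0`, with a large constant
    (∀ ε : ℝ, ∃ c₀ : ℝ, 0 < c₀ ∧
      ∀ c, c₀ ≤ c → GevreyStable W ε ψ 100 c ∧ GevreyStable W ε ψ 0 c) ∧
    -- for small amplitudes the constant `2` is large enough
    (∃ ε₀ : ℝ, 0 < ε₀ ∧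
      ∀ ε : ℝ, |ε| ≤ ε₀ → GevreyStable W ε ψ 100 2 ∧ GevreyStable W ε ψ 0 2) := by
  obtain ⟨M, hM0, hM⟩ := exists_norm_psiHat_le ψ
  refine ⟨fun ε T₀ hT₀ h₀ hm hfin => ?_, fun ε c hc => ?_, fun ε => ?_, ?_⟩
  · obtain ⟨h, sol⟩ := exists_isLVPSolution hW hψ ε T₀ hm hfin
    exact ⟨h, sol, fun h' sol' t ht => sol'.unique hW hδ hδ' hψ hT₀ sol ht⟩
  · obtain ⟨C, hC⟩ := exists_gevreyEnergy_Icc_le hW hδ hδ' hψ ε hc.le le_rfl 100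
    exact ⟨C, fun h₀ h hm _ sol => (hC h₀ h hm sol).2⟩
  · have hb : 0 ≤ |ε| * M := by positivity
    refine ⟨132 / 100 + 66 / 10 * (|ε| * M + 1), by positivity, fun c hc => ?_⟩
    -- `b = |ε| M + 1` satisfies `|ε| M ≤ b ≤ b ^ 3`
    have hst := gevreyStable_hundred hW hδ hδ' hψ hM (b := |ε| * M + 1) (by positivity)
      (by nlinarith [pow_le_pow_right₀ (by linarith : 1 ≤ |ε| * M + 1) (by norm_num : 1 ≤ 3)]) hc
    exact ⟨hst, gevreyStable_zero hW hδ hδ' hψ (by linarith) hst⟩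
  · refine ⟨1 / (1000 * (M + 1)), by positivity, fun ε hε => ?_⟩
    -- with `b = 1 / 10` the exponents need `1.32 + 6.6 b = 1.98 ≤ 2`
    have hst := gevreyStable_hundred hW hδ hδ' hψ hM (b := 1 / 10) (c := 2) (ε := ε) (by norm_num)
      (by
        rw [le_div_iff₀ (by positivity)] at hε
        nlinarith [abs_nonneg ε]) (by norm_num)
    exact ⟨hst, gevreyStable_zero hW hδ hδ' hψ (by norm_num) hst⟩
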